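/- There is an absolute constant $K$ such that the following holds. Let $G=(V,E)$ be a finite unweighted tree with maximum degree at most $\Delta$, root $r$, goal $g\in V$, predictions $f:V\to\mathbb{Z}$, and let $\mathcal{E}=\{v\in V: f(v)\neq d(v,g)\}$ be the set of erroneous nodes. If $D=d(r,g)$, then the algorithm TreeX-KnownDist$(r,D,+\infty)$ described below, with ties broken arbitrarily, always visits unvisited neighbours of the set of visited nodes, terminates, and ends at $g$, with total movement cost $\sum_{t\ge 1} d(v_{t-1},v_t)\le d(r,g)+K\,\Delta\,|\mathcal{E}|$. *Notions.* The level of $v$ is $\ell(v)=d(r,v)$, and $T_v$ is the set of descendants of $v$ (including $v$). The anchor $\tau(u)$ of a node $u$ is the ancestor of $u$ (possibly $u$ itself) at level $\frac12(D+\ell(u)-f(u))$; if there is none, $\tau(u)=\bot$. Let $V_t=\{v_0,\dots,v_t\}$ be the set of visited nodes and $\partial V_t$ the set of their unvisited neighbours. A node $v\in V_t\cup\partial V_t$ is active if it has a descendant (possibly itself) in $\partial V_t$, and an active node is degenerate if exactly one of its children is active. For a child $c$ of $v$, the load $\sigma_c(v)$ is the number of $u\in T_c\cap V_t$ with $\tau(u)=v$.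 An active non-degenerate node $v$ is critical with respect to its child $j$ if, with $q$ an active child of $v$ other than $j$ of least load, $\sigma_j(v)\ge 2\sigma_q(v)$ and $2\sigma_j(v)\ge |T_j\cap V_t|$. *Algorithm* TreeX-KnownDist$(r,D,B)$. Start with $v_0=r$, $\mathrm{mem}(r)=r$, and $\mathrm{mem}(v)=\bot$ for $v\ne r$. While $v_t\ne g$ and $|V_t|<B$, do the following. (1) If $\tau(v_t)\neq\bot$, $\tau(v_t)\ne v_t$ and $\tau(v_t)$ is critical with respect to its child $j$ with $v_t\in T_j$, let $q$ be an active child of $\tau(v_t)$ other than $j$ of least load; set $v_{t+1}=q$ if $\mathrm{mem}(q)=\bot$, and $u=\mathrm{mem}(q)$ otherwise. If the condition fails, set $u=v_t$. (2) While $v_{t+1}$ is undefined and $u$ has no child, let $w$ be the closest active ancestor of $u$ and $q$ an active child of $w$ of least load; set $v_{t+1}=q$ if $\mathrm{mem}(q)=\bot$, and $u=\mathrm{mem}(q)$ otherwise. (3) If $v_{t+1}$ is still undefined, let $v_{t+1}$ be a child of $u$ with the smallest prediction. (4) Move to $v_{t+1}$, set $\mathrm{mem}(x)=v_{t+1}$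 for every ancestor $x$ of $v_{t+1}$ (including itself), and increase $t$ by one. -/

import Mathlib

namespace TreeX

variable {V : Type*}

/-- The level `ℓ(v) = d(r, v)` of a node of the tree `G` rooted at `r`. -/
noncomputable def level (G : SimpleGraph V) (r v : V) : ℕ := G.dist r v

/-- `a` is an ancestor of `v` (equivalently, `v` is in the subtree `T_a`): `a` lies on the path from
the root `r` to `v`. Every node is an ancestor of itself. -/
def IsAncestor (G : SimpleGraph V) (r a v : V) : Prop :=
  G.dist r a + G.dist a v = G.dist r v

/-- `c` is a child of `p`. -/
def IsChild (G : SimpleGraph V) (r p c : V) : Prop :=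
  G.Adj p c ∧ level G r c = level G r p + 1

/-- `a` is the anchor `τ(u)` of `u`: the ancestor of `u` at level `(D + ℓ(u) - f(u)) / 2`. If that
number is negative, not an integer, or larger than `ℓ(u)`, no node `a` qualifies: `τ(u) = ⊥`. -/
def IsAnchor (G : SimpleGraph V) (r : V) (f : V → ℤ) (D : ℤ) (u a : V) : Prop :=
  IsAncestor G r a u ∧ 2 * (level G r a : ℤ) = D + (level G r u : ℤ) - f u

/-- The frontier `∂S`: the unvisited neighbours of the set `S` of visited nodes. -/
def frontier (G : SimpleGraph V) (S : Set V) : Set V :=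
  {u | u ∉ S ∧ ∃ w ∈ S, G.Adj w u}

/-- The nodes of the subtree at `v` of the visited tree `T[S]`. -/
def visitedSubtree (G : SimpleGraph V) (r : V) (S : Set V) (v : V) : Set V :=
  {u | u ∈ S ∧ IsAncestor G r v u}

/-- The nodes of the subtree at `v` of the extended tree `T[S ∪ ∂S]`. -/
def extendedSubtree (G : SimpleGraph V) (r : V) (S : Set V) (v : V) : Set V :=
  {u | u ∈ S ∪ frontier G S ∧ IsAncestor G r v u}

/-- An observed node is active if it has an observed descendant that is not visited. -/
def IsActive (G : SimpleGraph V) (r : V) (S : Set V) (v : V) : Prop :=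
  v ∈ S ∪ frontier G S ∧ visitedSubtree G r S v ≠ extendedSubtree G r S v

/-- An active node is degenerate if exactly one of its (observed) children is active. -/
def IsDegenerate (G : SimpleGraph V) (r : V) (S : Set V) (v : V) : Prop :=
  IsActive G r S v ∧ ∃! c, IsChild G r v c ∧ IsActive G r S c

/-- The load `σ_c(v)`, for a child `c` of `v`: the number of visited nodes in the subtree of `c` that
have `v` as their anchor. -/
noncomputable def load (G : SimpleGraph V) (r : V) (f : V → ℤ) (D : ℤ) (S : Set V) (v c : V) : ℕ :=
  {u | u ∈ visitedSubtree G r S c ∧ IsAnchor G r f D u v}.ncard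

/-- `q` attains `argmin {σ_i(v) | i an active child of v}`. -/
def IsLeastLoaded (G : SimpleGraph V) (r : V) (f : V → ℤ) (D : ℤ) (S : Set V) (v q : V) : Prop :=
  IsChild G r v q ∧ IsActive G r S q ∧
    ∀ i, IsChild G r v i → IsActive G r S i → load G r f D S v q ≤ load G r f D S v i

/-- `q` attains `argmin {σ_i(v) | i ≠ j an active child of v}`. -/
def IsLeastLoadedExcept (G : SimpleGraph V) (r : V) (f : V → ℤ) (D : ℤ) (S : Set V)
    (v j q : V) : Prop :=
  q ≠ j ∧ IsChild G r v q ∧ IsActive G r S q ∧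
    ∀ i, i ≠ j → IsChild G r v i → IsActive G r S i → load G r f D S v q ≤ load G r f D S v i

/-- `v` is active, not degenerate, and critical with respect to its child `j`, where `q` is a least
loaded active child of `v` other than `j`. -/
def IsCritical (G : SimpleGraph V) (r : V) (f : V → ℤ) (D : ℤ) (S : Set V) (v j q : V) : Prop :=
  IsActive G r S v ∧ ¬ IsDegenerate G r S v ∧ IsChild G r v j ∧
    IsLeastLoadedExcept G r f D S v j q ∧
    2 * load G r f D S v q ≤ load G r f D S v j ∧
    (visitedSubtree G r S j).ncard ≤ 2 * load G r f D S v j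

/-- `w` is the closest active ancestor of `u`. -/
def IsClosestActiveAncestor (G : SimpleGraph V) (r : V) (S : Set V) (u w : V) : Prop :=
  IsAncestor G r w u ∧ IsActive G r S w ∧
    ∀ w', IsAncestor G r w' u → IsActive G r S w' → level G r w' ≤ level G r w

/-- The state of the program. -/
structure State (V : Type*) where
  /-- the current node `v_t` -/
  cur : V
  /-- the set `V_t` of visited nodes -/
  visited : Set V
  /-- the memory `mem`, with `none` for `⊥` -/
  mem : V → Option V
  /-- the total movement cost so far, `∑_{s ≤ t} d(v_{s-1}, v_s)` -/
  cost : ℕ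
  /-- the program counter: `none` at the test of the outer loop, `some u` at the test of the inner
  loop when the variable `u` has this value and `v_{t+1}` is undefined -/
  pending : Option V

open Classical in
/-- The initial state. -/
noncomputable def init (r : V) : State V where
  cur := r
  visited := {r}
  mem := fun v => if v = r then some r else none
  cost := 0
  pending := none

open Classical in
/-- The agent moves to `x = v_{t+1}`, pays for the movement, sets `mem` to `x` at all ancestors
of `x`, and the program returns to the test of the outer loop. -/
noncomputable def State.visit (G : SimpleGraph V) (r : V) (s : State V) (x : V) : State V where
  cur := x
  visited := insert x s.visited
  mem := fun u => if IsAncestor G r u x then some x else s.mem u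
  cost := s.cost + G.dist s.cur x
  pending := none

/-- The program is at the test of the outer loop, `v_t ≠ g` and `|V_t| < B`, and the test succeeds. -/
def EntersLoop (g : V) (B : ℕ∞) (s : State V) : Prop :=
  s.pending = none ∧ s.cur ≠ g ∧ s.visited.encard < B

/-- The anchor of the current node is `a`, and it is active, not degenerate and critical with respect
to its child whose subtree contains the current node; `q` is a least loaded active child of `a` other
than that one. -/
def CallsBack (G : SimpleGraph V) (r : V) (f : V → ℤ) (D : ℤ) (s : State V) (a q : V) : Prop :=
  IsAnchor G r f D s.cur a ∧ ∃ j, IsAncestor G r j s.cur ∧ IsCritical G r f D s.visited a j q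

/-- One elementary step of the program `TreeX-KnownDist(r, D, B)`, on the tree `G` with predictions
`f` and goal `g`. Ties in a minimum are broken arbitrarily. -/
inductive Step (G : SimpleGraph V) (r g : V) (f : V → ℤ) (D : ℤ) (B : ℕ∞) (s : State V) :
    State V → Prop
  /-- The anchor is critical, and the chosen child `q` of it is new. -/
  | callbackNew (a q : V) (hs : EntersLoop g B s) (ha : CallsBack G r f D s a q)
      (hq : s.mem q = none) : Step G r g f D B s (s.visit G r q)
  /-- The anchor is critical, and the search below the chosen child `q` of it is resumed at `u`. -/
  | callbackResume (a q u : V) (hs : EntersLoop g B s) (ha : CallsBack G r f D s a q)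
      (hq : s.mem q = some u) : Step G r g f D B s { s with pending := some u }
  /-- There is no anchor or it is not critical: the search goes on at the current node. -/
  | proceed (hs : EntersLoop g B s) (ha : ¬ ∃ a q, CallsBack G r f D s a q) :
      Step G r g f D B s { s with pending := some s.cur }
  /-- `u` has no child, and the chosen child `q` of its closest active ancestor `w` is new. -/
  | backtrackNew (u w q : V) (hs : s.pending = some u) (hu : ¬ ∃ c, IsChild G r u c)
      (hw : IsClosestActiveAncestor G r s.visited u w)
      (hq : IsLeastLoaded G r f D s.visited w q) (hm : s.mem q = none) :
      Step G r g f D B s (s.visit G r q)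
  /-- `u` has no child, and the search below the chosen child `q` of its closest active ancestor `w`
  is resumed at `u'`. -/
  | backtrackResume (u w q u' : V) (hs : s.pending = some u) (hu : ¬ ∃ c, IsChild G r u c)
      (hw : IsClosestActiveAncestor G r s.visited u w)
      (hq : IsLeastLoaded G r f D s.visited w q) (hm : s.mem q = some u') :
      Step G r g f D B s { s with pending := some u' }
  /-- `u` has a child: the agent moves to a child `x` of `u` with the smallest prediction. -/
  | descend (u x : V) (hs : s.pending = some u) (hx : IsChild G r u x)
      (hmin : ∀ c, IsChild G r u c → f x ≤ f c) : Step G r g f D B s (s.visit G r x)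

/-- `s` is a state that some run of the program `TreeX-KnownDist(r, D, B)` reaches. -/
def Reachable (G : SimpleGraph V) (r g : V) (f : V → ℤ) (D : ℤ) (B : ℕ∞) (s : State V) : Prop :=
  Relation.ReflTransGen (Step G r g f D B) (init r) s

/-- The set of erroneous nodes. -/
def erroneous (G : SimpleGraph V) (g : V) (f : V → ℤ) : Set V :=
  {v | f v ≠ (G.dist v g : ℤ)}

end TreeX

/-!
The proof follows the search by the *focus*: the current node, or the node `u` at which the inner
loop would resume the search. A step that changes the focus either visits a child of it, or turns
at an ancestor `w` of the focus to another child `q` of `w`, where it visits `q` or resumes the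
search at `mem q`. The search leaves a subtree that still has unvisited nodes only by a callback
(`Leaves.exists_callback`). Hence, wherever the search is resumed, it was suspended by a callback
to the very node `w` at which it turns now, and at least half of the visited nodes below `q` are
anchored at `w` (`Turn.parked`).

*Visits off the path to the goal.* A correct node is anchored where the paths from the root to it
and to the goal part. Let `h` be a node of the path to the goal, `p` its child on the path and `c`
another child. Visited nodes below `c` that are not anchored at `h` are erroneous, and so are nodes
below `p` that are anchored at `h`. Hence the load of `p` counts errors, and `h` is critical with
respect to `c` as soon as the subtree of `c` has more visited nodes than twice the sum of its
errors and the load of `p`. Beyond this bound, each visit below `c` can be charged to the node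
visited last below `c`, which is erroneous (`OffPathBounded`). Moreover an off-path child of `h` is
visited at all only if a child of `h` is erroneous or some node below `p` is anchored at `h`
(`DetoursWitnessed`). Summing over all `h` and `c`, the number of off-path visits is at most
`3 |ℰ| + 4 Δ |ℰ|` (`Invariant.ncard_visitedOffPath_le`).

*Movement cost.* The last edge of each movement is paid by the visit. Going up by backtracking is
paid by the nodes of the exhausted subtree that is left for good (`deadSet`). A callback to `a`
from below its child `j`, and the later return to `j`, each cost at most twice the load of `j`;
between two callbacks from `j` this load doubles, because `j` is least loaded when the search
returns to it, so that these costs sum to at most eight times the final load of `j` (`IsLedger`).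
The sum of all loads is at most the number of off-path visits plus the number of errors.
-/

/-! ### Ancestors in a rooted tree -/

namespace TreeX

variable {V : Type*} {G : SimpleGraph V} {r g : V}

theorem IsAncestor.refl (G : SimpleGraph V) (r v : V) : IsAncestor G r v v := by
  simp [IsAncestor]

theorem isAncestor_root (G : SimpleGraph V) (r v : V) : IsAncestor G r r v := by
  simp [IsAncestor]

theorem IsAncestor.level_le {a v : V} (h : IsAncestor G r a v) : level G r a ≤ level G r v := by
  unfold IsAncestor at h; unfold level; omega

theorem IsAncestor.trans (hG : G.IsTree) {a b c : V} (h₁ : IsAncestor G r a b)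
    (h₂ : IsAncestor G r b c) : IsAncestor G r a c := by
  have e₁ := hG.connected.dist_triangle (u := a) (v := b) (w := c)
  have e₂ := hG.connected.dist_triangle (u := r) (v := a) (w := c)
  unfold IsAncestor at *; omega

theorem IsAncestor.eq_of_level_le (hG : G.IsTree) {a b : V} (h : IsAncestor G r a b)
    (hl : level G r b ≤ level G r a) : a = b := by
  unfold IsAncestor at h
  unfold level at hl
  exact hG.connected.dist_eq_zero_iff.1 (by omega)

theorem IsAncestor.antisymm (hG : G.IsTree) {a b : V} (h₁ : IsAncestor G r a b)
    (h₂ : IsAncestor G r b a) : a = b :=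
  h₁.eq_of_level_le hG h₂.level_le

theorem IsChild.isAncestor {p c : V} (h : IsChild G r p c) : IsAncestor G r p c := by
  have := SimpleGraph.dist_eq_one_iff_adj.2 h.1
  have := h.2
  unfold level at this; unfold IsAncestor; omega

theorem IsChild.not_isAncestor {p c : V} (h : IsChild G r p c) : ¬ IsAncestor G r c p := by
  intro h'
  have := h'.level_le
  have := h.2
  omega

theorem IsChild.ne {p c : V} (h : IsChild G r p c) : p ≠ c := h.1.ne

theorem IsChild.ne_root {p c : V} (h : IsChild G r p c) : c ≠ r := by
  rintro rfl
  have := h.2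
  simp [level] at this

theorem isChild_or_isChild_of_adj (hG : G.IsTree) (r : V) {u v : V} (h : G.Adj u v) :
    IsChild G r u v ∨ IsChild G r v u := by
  rcases hG.dist_eq_dist_add_one_of_adj r h with h' | h'
  · exact Or.inr ⟨h.symm, h'⟩
  · exact Or.inl ⟨h, h'⟩

theorem IsChild.parent_unique (hG : G.IsTree) {p q c : V} (hp : IsChild G r p c)
    (hq : IsChild G r q c) : p = q := by
  obtain ⟨w, hw, hwl⟩ := hG.connected.exists_path_of_dist r c
  have key : ∀ x, IsChild G r x c → x = w.penultimate := by
    intro x hx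
    obtain ⟨v, hv, hvl⟩ := hG.connected.exists_path_of_dist r x
    have hl : (v.concat hx.1).length = G.dist r c := by
      rw [SimpleGraph.Walk.length_concat, hvl]; exact hx.2.symm
    have hpath := SimpleGraph.Walk.isPath_of_length_eq_dist _ hl
    have e : v.concat hx.1 = w :=
      congrArg Subtype.val ((hG.isAcyclic.subsingleton_path r c).elim ⟨_, hpath⟩ ⟨w, hw⟩)
    rw [← e]; simp
  rw [key p hp, key q hq]

theorem exists_adj_dist_add_one (hG : G.IsTree) {a v : V} (h : a ≠ v) :
    ∃ c, G.Adj a c ∧ G.dist a v = G.dist c v + 1 := by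
  obtain ⟨w, hw⟩ := hG.connected.exists_walk_length_eq_dist a v
  cases w with
  | nil => exact absurd rfl h
  | @cons _ c _ hac w =>
    refine ⟨c, hac, ?_⟩
    have h₁ := SimpleGraph.dist_le w
    have h₂ := hG.connected.dist_triangle (u := a) (v := c) (w := v)
    have h₃ := SimpleGraph.dist_eq_one_iff_adj.2 hac
    simp at hw; omega

/-- A proper ancestor `a` of `v` has a child that is an ancestor of `v`. -/
theorem IsAncestor.exists_child (hG : G.IsTree) {a v : V} (h : IsAncestor G r a v) (hne : a ≠ v) :
    ∃ c, IsChild G r a c ∧ IsAncestor G r c v := by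
  obtain ⟨c, hc, hd⟩ := exists_adj_dist_add_one hG hne
  have h₂ := hG.connected.dist_triangle (u := r) (v := a) (w := c)
  have h₃ := hG.connected.dist_triangle (u := r) (v := c) (w := v)
  have h₄ := SimpleGraph.dist_eq_one_iff_adj.2 hc
  unfold IsAncestor at h
  refine ⟨c, ⟨hc, ?_⟩, ?_⟩
  · unfold level; omega
  · unfold IsAncestor; omega

theorem exists_parent (hG : G.IsTree) {v : V} (h : v ≠ r) : ∃ p, IsChild G r p v := by
  obtain ⟨p, hp, hd⟩ := exists_adj_dist_add_one hG h
  refine ⟨p, hp.symm, ?_⟩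
  unfold level
  rw [SimpleGraph.dist_comm, hd, SimpleGraph.dist_comm]

/-- A proper ancestor of a child is an ancestor of the parent. -/
theorem IsAncestor.of_child (hG : G.IsTree) {a p c : V} (h : IsAncestor G r a c)
    (hc : IsChild G r p c) (hne : a ≠ c) : IsAncestor G r a p := by
  obtain ⟨q, hq, hd⟩ := exists_adj_dist_add_one hG (Ne.symm hne)
  have h₂ := hG.connected.dist_triangle (u := r) (v := a) (w := q)
  have h₃ := hG.connected.dist_triangle (u := r) (v := q) (w := c)
  have h₄ := SimpleGraph.dist_eq_one_iff_adj.2 hq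
  rw [SimpleGraph.dist_comm (u := c), SimpleGraph.dist_comm (u := q)] at hd
  rw [SimpleGraph.dist_comm] at h₄
  unfold IsAncestor at h
  have hqc : IsChild G r q c := ⟨hq.symm, by unfold level; omega⟩
  rw [hc.parent_unique hG hqc]
  unfold IsAncestor; omega

theorem IsAncestor.total (hG : G.IsTree) {a b v : V} (ha : IsAncestor G r a v)
    (hb : IsAncestor G r b v) : IsAncestor G r a b ∨ IsAncestor G r b a := by
  induction hn : level G r v using Nat.strong_induction_on generalizing v with
  | _ n ih =>
    by_cases h₁ : a = v
    · subst h₁; exact Or.inr hb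
    by_cases h₂ : b = v
    · subst h₂; exact Or.inl ha
    have hv : v ≠ r := by
      rintro rfl
      exact h₁ (ha.eq_of_level_le hG (by simp [level]))
    obtain ⟨p, hp⟩ := exists_parent hG hv
    exact ih _ (by have := hp.2; omega) (ha.of_child hG hp h₁) (hb.of_child hG hp h₂) rfl

theorem IsAncestor.eq_of_level_eq (hG : G.IsTree) {a b v : V} (ha : IsAncestor G r a v)
    (hb : IsAncestor G r b v) (h : level G r a = level G r b) : a = b := by
  rcases ha.total hG hb with h' | h'
  · exact h'.eq_of_level_le hG h.ge
  · exact (h'.eq_of_level_le hG h.le).symm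

theorem IsAncestor.of_level_le (hG : G.IsTree) {a b v : V} (ha : IsAncestor G r a v)
    (hb : IsAncestor G r b v) (h : level G r a ≤ level G r b) : IsAncestor G r a b := by
  rcases ha.total hG hb with h' | h'
  · exact h'
  · rw [h'.eq_of_level_le hG h]; exact .refl ..

/-- Siblings have disjoint subtrees. -/
theorem IsChild.eq_of_isAncestor (hG : G.IsTree) {p c c' v : V} (hc : IsChild G r p c)
    (hc' : IsChild G r p c') (h : IsAncestor G r c v) (h' : IsAncestor G r c' v) : c = c' :=
  h.eq_of_level_eq hG h' (by rw [hc.2, hc'.2])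

theorem mem_support_of_walk_leaving_subtree (hG : G.IsTree) {h c : V} (hc : IsChild G r h c)
    {x y : V} (w : G.Walk x y) (hx : IsAncestor G r c x) (hy : ¬ IsAncestor G r c y) :
    h ∈ w.support := by
  induction w with
  | nil => exact absurd hx hy
  | @cons x z y hxz w ih =>
    by_cases hz : IsAncestor G r c z
    · simp [ih hz hy]
    · have hzx : IsChild G r z x := by
        rcases isChild_or_isChild_of_adj hG r hxz with h' | h'
        · exact absurd (hx.trans hG h'.isAncestor) hz
        · exact h'
      have hcx : c = x := by
        by_contra hne
        exact hz (hx.of_child hG hzx hne)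
      subst hcx
      rw [hc.parent_unique hG hzx]
      simp

/-- Paths that leave the subtree of `c` go through the parent of `c`. -/
theorem IsChild.dist_add_dist (hG : G.IsTree) {h c x y : V} (hc : IsChild G r h c)
    (hx : IsAncestor G r c x) (hy : ¬ IsAncestor G r c y) :
    G.dist x h + G.dist h y = G.dist x y := by
  classical
  obtain ⟨w, hw⟩ := hG.connected.exists_walk_length_eq_dist x y
  have hs := mem_support_of_walk_leaving_subtree hG hc w hx hy
  have h₁ := SimpleGraph.dist_le (w.takeUntil h hs)
  have h₂ := SimpleGraph.dist_le (w.dropUntil h hs)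
  have h₃ := hG.connected.dist_triangle (u := x) (v := h) (w := y)
  have h₄ := congrArg SimpleGraph.Walk.length (w.take_spec hs)
  rw [SimpleGraph.Walk.length_append] at h₄
  omega

/-- The meeting point of `u` and `g`: their deepest common ancestor, which lies on the path between
them. -/
theorem exists_deepest_common_ancestor (hG : G.IsTree) (r u g : V) :
    ∃ m, IsAncestor G r m u ∧ IsAncestor G r m g ∧
      (∀ x, IsAncestor G r x u → IsAncestor G r x g → IsAncestor G r x m) ∧
      G.dist u m + G.dist m g = G.dist u g := by
  have key : ∀ n a, IsAncestor G r a u → IsAncestor G r a g → level G r u = level G r a + n →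
      ∃ m, IsAncestor G r m u ∧ IsAncestor G r m g ∧
      (∀ x, IsAncestor G r x u → IsAncestor G r x g → IsAncestor G r x m) ∧
      G.dist u m + G.dist m g = G.dist u g := by
    intro n
    induction n with
    | zero =>
      intro a ha hag hl
      obtain rfl := ha.eq_of_level_le hG (by omega)
      exact ⟨a, ha, hag, fun x hx _ => hx, by simp⟩
    | succ n ih =>
      intro a ha hag hl
      have hne : a ≠ u := by rintro rfl; omega
      obtain ⟨c, hc, hcu⟩ := ha.exists_child hG hne
      by_cases hcg : IsAncestor G r c g
      · exact ih c hcu hcg (by rw [hc.2]; omega)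
      · refine ⟨a, ha, hag, fun x hx hxg => ?_, hc.dist_add_dist hG hcu hcg⟩
        rcases hx.total hG hcu with h | h
        · exact h.of_child hG hc (by rintro rfl; exact hcg hxg)
        · exact absurd (h.trans hG hxg) hcg
  exact key (level G r u) r (isAncestor_root ..) (isAncestor_root ..) (by simp [level])

theorem IsAncestor.level_add_dist {a v : V} (h : IsAncestor G r a v) :
    level G r a + G.dist a v = level G r v := h

theorem IsAncestor.ncard_between [Finite V] (hG : G.IsTree) {a v : V} (h : IsAncestor G r a v) :
    {x | IsAncestor G r a x ∧ IsAncestor G r x v}.ncard = G.dist a v + 1 := by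
  obtain ⟨n, hn⟩ : ∃ n, G.dist a v = n := ⟨_, rfl⟩
  induction n generalizing a with
  | zero =>
    obtain rfl := hG.connected.dist_eq_zero_iff.1 hn
    rw [hn, Set.ncard_eq_one]
    refine ⟨a, Set.eq_singleton_iff_unique_mem.2 ⟨⟨h, h⟩, fun x hx => hx.2.antisymm hG hx.1⟩⟩
  | succ n ih =>
    have hne : a ≠ v := by rintro rfl; simp at hn
    obtain ⟨c, hc, hcv⟩ := h.exists_child hG hne
    have hd : G.dist c v = n := by
      have := h.level_add_dist; have := hcv.level_add_dist; have := hc.2; omega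
    have : {x | IsAncestor G r a x ∧ IsAncestor G r x v} =
        insert a {x | IsAncestor G r c x ∧ IsAncestor G r x v} := by
      ext x
      simp only [Set.mem_ofPred_eq, Set.mem_insert_iff]
      constructor
      · rintro ⟨h₁, h₂⟩
        rcases eq_or_ne x a with rfl | hx
        · exact Or.inl rfl
        · obtain ⟨c', hc', hcx⟩ := h₁.exists_child hG (Ne.symm hx)
          rw [← hc'.eq_of_isAncestor hG hc (hcx.trans hG h₂) hcv]
          exact Or.inr ⟨hcx, h₂⟩
      · rintro (rfl | ⟨h₁, h₂⟩)
        · exact ⟨.refl .., h⟩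
        · exact ⟨hc.isAncestor.trans hG h₁, h₂⟩
    rw [this, Set.ncard_insert_of_notMem (fun h => hc.not_isAncestor h.1) (Set.toFinite _),
      ih hcv hd, hd, hn]

end TreeX

/-! ### Active nodes and anchors -/

namespace TreeX

variable {V : Type*} {G : SimpleGraph V} {r g : V} {f : V → ℤ} {D : ℤ} {S : Set V}

/-- Some node of the subtree at `v` is unvisited. For visited nodes and for children of visited
nodes this means that `v` is active, but unlike activity it is antitone in the set `S` of visited
nodes. -/
def HasUnvisited (G : SimpleGraph V) (r : V) (S : Set V) (v : V) : Prop :=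
  ∃ d, IsAncestor G r v d ∧ d ∉ S

theorem HasUnvisited.anti {S' : Set V} (h : S ⊆ S') {v : V} (hv : HasUnvisited G r S' v) :
    HasUnvisited G r S v :=
  let ⟨d, hd, hdS⟩ := hv
  ⟨d, hd, fun h' => hdS (h h')⟩

theorem HasUnvisited.of_notMem {v : V} (hv : v ∉ S) : HasUnvisited G r S v :=
  ⟨v, .refl .., hv⟩

theorem exists_mem_frontier (hG : G.IsTree) {v d : V} (hv : v ∈ S) (hvd : IsAncestor G r v d)
    (hd : d ∉ S) : ∃ u ∈ frontier G S, IsAncestor G r v u := by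
  obtain ⟨n, hn⟩ : ∃ n, G.dist v d = n := ⟨_, rfl⟩
  induction n generalizing v with
  | zero => exact absurd (hG.connected.dist_eq_zero_iff.1 hn ▸ hv) hd
  | succ n ih =>
    obtain ⟨c, hc, hcd⟩ := hvd.exists_child hG (by rintro rfl; exact hd hv)
    by_cases hcS : c ∈ S
    · obtain ⟨u, hu, hcu⟩ := ih hcS hcd (by
        have := hvd.level_add_dist; have := hcd.level_add_dist; have := hc.2; omega)
      exact ⟨u, hu, hc.isAncestor.trans hG hcu⟩
    · exact ⟨c, ⟨hcS, v, hv, hc.1⟩, hc.isAncestor⟩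

theorem isActive_iff (hG : G.IsTree) {v : V} :
    IsActive G r S v ↔ v ∈ S ∪ frontier G S ∧ HasUnvisited G r S v := by
  refine and_congr_right fun hv => ⟨fun h => ?_, fun ⟨d, hd, hdS⟩ h => ?_⟩
  · by_contra h'
    refine h (Set.Subset.antisymm (fun u hu => ⟨Or.inl hu.1, hu.2⟩) fun u hu => ⟨?_, hu.2⟩)
    by_contra huS
    exact h' ⟨u, hu.2, huS⟩
  · have key : ∀ u ∈ frontier G S, ¬ IsAncestor G r v u := fun u hu hvu =>
      hu.1 ((h.symm ▸ (⟨Or.inr hu, hvu⟩ : u ∈ extendedSubtree G r S v) :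
        u ∈ visitedSubtree G r S v)).1
    rcases hv with hv | hv
    · obtain ⟨u, hu, hvu⟩ := exists_mem_frontier hG hv hd hdS
      exact key u hu hvu
    · exact key v hv (.refl ..)

theorem isActive_iff_of_mem (hG : G.IsTree) {v : V} (hv : v ∈ S) :
    IsActive G r S v ↔ HasUnvisited G r S v := by
  rw [isActive_iff hG]; exact and_iff_right (Or.inl hv)

theorem isActive_iff_of_isChild (hG : G.IsTree) {v c : V} (hv : v ∈ S) (hc : IsChild G r v c) :
    IsActive G r S c ↔ HasUnvisited G r S c := by
  rw [isActive_iff hG]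
  refine and_iff_right ?_
  by_cases h : c ∈ S
  · exact Or.inl h
  · exact Or.inr ⟨h, v, hv, hc.1⟩

theorem IsAnchor.unique (hG : G.IsTree) {u a b : V} (ha : IsAnchor G r f D u a)
    (hb : IsAnchor G r f D u b) : a = b :=
  ha.1.eq_of_level_eq hG hb.1 (by have := ha.2; have := hb.2; omega)

/-- The anchor of a node with a correct prediction is the node where the paths from the root to the
node and to the goal part. -/
theorem exists_isAnchor_of_correct (hG : G.IsTree) (hD : D = G.dist r g) {u : V}
    (hu : f u = G.dist u g) : ∃ m, IsAnchor G r f D u m ∧ IsAncestor G r m g ∧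
      ∀ x, IsAncestor G r x u → IsAncestor G r x g → IsAncestor G r x m := by
  obtain ⟨m, hmu, hmg, hmax, hdist⟩ := exists_deepest_common_ancestor hG r u g
  refine ⟨m, ⟨hmu, ?_⟩, hmg, hmax⟩
  have h₁ := hmu.level_add_dist
  have h₂ := hmg.level_add_dist
  rw [SimpleGraph.dist_comm (u := u) (v := m)] at hdist
  unfold level at *
  rw [hD, hu]
  omega

/-- Correct nodes that hang off the path to the goal at `h` are anchored at `h`. -/
theorem isAnchor_of_correct (hG : G.IsTree) (hD : D = G.dist r g) {h c u : V}
    (hh : IsAncestor G r h g) (hc : IsChild G r h c) (hcg : ¬ IsAncestor G r c g)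
    (hcu : IsAncestor G r c u) (hu : f u = G.dist u g) : IsAnchor G r f D u h := by
  obtain ⟨m, hm, hmg, hmax⟩ := exists_isAnchor_of_correct hG hD hu
  have h₁ := hmax h (hc.isAncestor.trans hG hcu) hh
  have h₂ : IsAncestor G r m c := by
    rcases hm.1.total hG hcu with h' | h'
    · exact h'
    · exact absurd (h'.trans hG hmg) hcg
  have h₃ := h₂.of_child hG hc (by rintro rfl; exact hcg hmg)
  rwa [h₁.antisymm hG h₃]

/-- A node below the child `p` of `h` on the path to the goal that is anchored at `h` is erroneous.
-/
theorem mem_erroneous_of_isAnchor (hG : G.IsTree) (hD : D = G.dist r g) {h p u : V}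
    (hp : IsChild G r h p) (hpg : IsAncestor G r p g) (hpu : IsAncestor G r p u)
    (hu : IsAnchor G r f D u h) : u ∈ erroneous G g f := by
  intro hc
  obtain ⟨m, hm, -, hmax⟩ := exists_isAnchor_of_correct hG hD hc
  obtain rfl := hm.unique hG hu
  exact hp.not_isAncestor (hmax p hpu hpg)

theorem IsAncestor.isAnchor_self (hG : G.IsTree) (hD : D = G.dist r g) {u : V}
    (h : IsAncestor G r u g) (hu : f u = G.dist u g) : IsAnchor G r f D u u := by
  obtain ⟨m, hm, -, hmax⟩ := exists_isAnchor_of_correct hG hD hu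
  have := hmax u (.refl ..) h
  rwa [← this.antisymm hG hm.1] at hm

theorem visitedSubtree_mono {S' : Set V} (h : S ⊆ S') (v : V) :
    visitedSubtree G r S v ⊆ visitedSubtree G r S' v := fun _ hu => ⟨h hu.1, hu.2⟩

theorem load_mono [Finite V] {S' : Set V} (h : S ⊆ S') (v c : V) :
    load G r f D S v c ≤ load G r f D S' v c :=
  Set.ncard_le_ncard (fun _ hu => ⟨visitedSubtree_mono h c hu.1, hu.2⟩) (Set.toFinite _)

/-- A visited node below `c` is at distance less than the number of visited nodes below `c`. -/
theorem dist_lt_ncard_visitedSubtree [Finite V] (hG : G.IsTree)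
    (hS : ∀ a v, v ∈ S → IsAncestor G r a v → a ∈ S) {c u : V} (hu : u ∈ S)
    (hcu : IsAncestor G r c u) : G.dist c u + 1 ≤ (visitedSubtree G r S c).ncard := by
  rw [← hcu.ncard_between hG]
  exact Set.ncard_le_ncard (fun x hx => ⟨hS x u hu hx.2, hx.1⟩) (Set.toFinite _)

theorem dist_le_ncard_visitedSubtree [Finite V] (hG : G.IsTree)
    (hS : ∀ a v, v ∈ S → IsAncestor G r a v → a ∈ S) {p c u : V} (hc : IsChild G r p c) (hu : u ∈ S)
    (hcu : IsAncestor G r c u) : G.dist p u ≤ (visitedSubtree G r S c).ncard := by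
  have h₁ := dist_lt_ncard_visitedSubtree hG hS hu hcu
  have h₂ := (hc.isAncestor.trans hG hcu).level_add_dist
  have h₃ := hcu.level_add_dist
  have h₄ := hc.2
  omega

/-! ### The moves of the program -/

/-- The node from which the search goes on: the value of the variable `u` in the inner loop, and the
current node otherwise. -/
def State.focus (s : State V) : V := s.pending.getD s.cur

/-- The bookkeeping invariant: visited nodes form a subtree containing the root, and `mem v` is the
node of the subtree at `v` visited last, so that nothing below it has been visited. -/
structure WellFormed (G : SimpleGraph V) (r g : V) (s : State V) : Prop where
  closed : ∀ a v, v ∈ s.visited → IsAncestor G r a v → a ∈ s.visited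
  mem_none : ∀ v, s.mem v = none ↔ v ∉ s.visited
  mem_visited : ∀ v m, s.mem v = some m → m ∈ s.visited
  mem_anc : ∀ v m, s.mem v = some m → IsAncestor G r v m
  coherent : ∀ v x m, s.mem v = some m → IsAncestor G r v x → IsAncestor G r x m → s.mem x = some m
  fresh : ∀ v m, s.mem v = some m → ∀ c, IsChild G r m c → c ∉ s.visited
  mem_root : s.mem r = some s.cur
  mem_focus : ∃ x, s.mem x = some s.focus
  goal : g ∈ s.visited → s.cur = g ∧ s.pending = none

/-- The agent is called back from its position, below the child `j` of its critical anchor `w`, to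
the child `q` of `w`. -/
structure Callback (G : SimpleGraph V) (r : V) (f : V → ℤ) (D : ℤ) (s : State V) (w q j : V) :
    Prop where
  pending : s.pending = none
  anchor : IsAnchor G r f D s.cur w
  child : IsChild G r w j
  anc : IsAncestor G r j s.cur
  ne : q ≠ j
  load_le : 2 * load G r f D s.visited w q ≤ load G r f D s.visited w j
  ncard_le : (visitedSubtree G r s.visited j).ncard ≤ 2 * load G r f D s.visited w j

/-- The search leaves the part of the tree below `w` that contains the focus, either by a callback
or because this part is exhausted. -/
def Leaves (G : SimpleGraph V) (r : V) (f : V → ℤ) (D : ℤ) (s : State V) (w q : V) : Prop :=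
  (∃ j, Callback G r f D s w q j) ∨
    s.pending ≠ none ∧
      ∀ x, HasUnvisited G r s.visited x → IsAncestor G r x s.focus → IsAncestor G r x w

/-- The search turns, by a callback or by backtracking, at the ancestor `w` of the focus to another
child `q` of `w`. -/
structure Turn (G : SimpleGraph V) (r : V) (f : V → ℤ) (D : ℤ) (s : State V) (w q : V) :
    Prop where
  anc : IsAncestor G r w s.focus
  ne : w ≠ s.focus
  child : IsChild G r w q
  unvisited : HasUnvisited G r s.visited q
  off : ¬ IsAncestor G r q s.focus
  least : ∀ i, IsChild G r w i → HasUnvisited G r s.visited i →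
    load G r f D s.visited w q ≤ load G r f D s.visited w i
  leaves : Leaves G r f D s w q

/-- The steps of the program, with callbacks and backtracking treated alike. -/
inductive Move (G : SimpleGraph V) (r : V) (f : V → ℤ) (D : ℤ) (s : State V) : State V → Prop
  | proceed (hs : s.pending = none) (ha : ¬ ∃ a q, CallsBack G r f D s a q) :
      Move G r f D s { s with pending := some s.cur }
  | descend (u x : V) (hs : s.pending = some u) (hx : IsChild G r u x)
      (hmin : ∀ c, IsChild G r u c → f x ≤ f c) : Move G r f D s (s.visit G r x)
  | turn (w q : V) (h : Turn G r f D s w q) (hq : q ∉ s.visited) : Move G r f D s (s.visit G r q)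
  | resume (w q u : V) (h : Turn G r f D s w q) (hq : s.mem q = some u) :
      Move G r f D s { s with pending := some u }

/-- The search visits the child `z` of the ancestor `w` of the focus. -/
structure Visits (G : SimpleGraph V) (r : V) (f : V → ℤ) (D : ℤ) (s : State V) (w z : V) :
    Prop where
  anc : IsAncestor G r w s.focus
  child : IsChild G r w z
  new : z ∉ s.visited
  leaves : Leaves G r f D s w z

namespace WellFormed

variable {s : State V}

theorem mem_eq_some (h : WellFormed G r g s) {v : V} (hv : v ∈ s.visited) :
    ∃ m, s.mem v = some m := by
  by_contra! hc
  exact (h.mem_none v).1 (Option.eq_none_iff_forall_ne_some.2 hc) hv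

theorem root_mem (h : WellFormed G r g s) : r ∈ s.visited :=
  h.closed r _ (h.mem_visited _ _ h.mem_root) (isAncestor_root ..)

theorem cur_mem (h : WellFormed G r g s) : s.cur ∈ s.visited := h.mem_visited _ _ h.mem_root

theorem focus_mem (h : WellFormed G r g s) : s.focus ∈ s.visited :=
  let ⟨_, hx⟩ := h.mem_focus
  h.mem_visited _ _ hx

theorem focus_fresh (h : WellFormed G r g s) {c : V} (hc : IsChild G r s.focus c) :
    c ∉ s.visited :=
  let ⟨_, hx⟩ := h.mem_focus
  h.fresh _ _ hx c hc

theorem mem_cur (h : WellFormed G r g s) {x : V} (hx : IsAncestor G r x s.cur) :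
    s.mem x = some s.cur :=
  h.coherent r x _ h.mem_root (isAncestor_root ..) hx

theorem visited_of_mem (h : WellFormed G r g s) {x m : V} (hx : s.mem x = some m) :
    x ∈ s.visited :=
  h.closed _ _ (h.mem_visited _ _ hx) (h.mem_anc _ _ hx)

end WellFormed

theorem wellFormed_init (hG : G.IsTree) (r g : V) : WellFormed G r g (init r) := by
  have hmem : ∀ v m, (init r).mem v = some m → v = r ∧ m = r := by
    intro v m h
    simp only [init] at h
    split_ifs at h with hv
    exact ⟨hv, (Option.some.inj h).symm⟩
  have hr : (init r).mem r = some r := by simp [init]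
  refine ⟨?_, ?_, ?_, ?_, ?_, ?_, hr, ⟨r, hr⟩, ?_⟩
  · rintro a v rfl ha
    exact ha.eq_of_level_le hG (by simp [level])
  · intro v; simp [init]
  · intro v m h; exact (hmem v m h).2
  · intro v m h; obtain ⟨rfl, rfl⟩ := hmem v m h; exact .refl ..
  · intro v x m h _ hx
    obtain ⟨rfl, rfl⟩ := hmem v m h
    rwa [hx.eq_of_level_le hG (by simp [level])]
  · intro v m h c hc hc'
    obtain ⟨rfl, rfl⟩ := hmem v m h
    exact hc.ne_root hc'
  · rintro rfl; exact ⟨rfl, rfl⟩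

theorem visit_mem_of_isAncestor {s : State V} {x z : V} (h : IsAncestor G r x z) :
    (s.visit G r z).mem x = some z := by simp [State.visit, h]

theorem visit_mem_of_not_isAncestor {s : State V} {x z : V} (h : ¬ IsAncestor G r x z) :
    (s.visit G r z).mem x = s.mem x := by simp [State.visit, h]

theorem WellFormed.visit (hG : G.IsTree) {s : State V} (hs : WellFormed G r g s)
    (hg : g ∉ s.visited) {w z : V} (hw : w ∈ s.visited) (hz : IsChild G r w z)
    (hzs : z ∉ s.visited) : WellFormed G r g (s.visit G r z) := by
  have hmem : ∀ v m, (s.visit G r z).mem v = some m →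
      (IsAncestor G r v z ∧ m = z) ∨ (¬ IsAncestor G r v z ∧ s.mem v = some m) := by
    intro v m h
    by_cases hv : IsAncestor G r v z
    · rw [visit_mem_of_isAncestor hv] at h
      exact Or.inl ⟨hv, (Option.some.inj h).symm⟩
    · rw [visit_mem_of_not_isAncestor hv] at h
      exact Or.inr ⟨hv, h⟩
  have hr : (s.visit G r z).mem r = some z := visit_mem_of_isAncestor (isAncestor_root ..)
  have hvis : (s.visit G r z).visited = insert z s.visited := rfl
  have hcl : ∀ a v, v ∈ insert z s.visited → IsAncestor G r a v → a ∈ insert z s.visited := by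
    rintro a v (rfl | hv) ha
    · by_cases h : a = v
      · exact Or.inl h
      · exact Or.inr (hs.closed a w hw (ha.of_child hG hz h))
    · exact Or.inr (hs.closed a v hv ha)
  refine ⟨hcl, ?_, ?_, ?_, ?_, ?_, hr, ⟨r, hr⟩, ?_⟩
  · intro v
    by_cases hv : IsAncestor G r v z
    · rw [visit_mem_of_isAncestor hv]
      simp [hcl v z (Or.inl rfl) hv, hvis]
    · rw [visit_mem_of_not_isAncestor hv, hs.mem_none]
      have : v ≠ z := by rintro rfl; exact hv (.refl ..)
      simp [hvis, this]
  · intro v m h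
    rcases hmem v m h with ⟨-, rfl⟩ | ⟨-, h⟩
    · exact Or.inl rfl
    · exact Or.inr (hs.mem_visited v m h)
  · intro v m h
    rcases hmem v m h with ⟨h, rfl⟩ | ⟨-, h⟩
    · exact h
    · exact hs.mem_anc v m h
  · intro v x m h hvx hxm
    rcases hmem v m h with ⟨h, rfl⟩ | ⟨hn, h⟩
    · exact visit_mem_of_isAncestor hxm
    · rw [visit_mem_of_not_isAncestor fun h' => hn (hvx.trans hG h')]
      exact hs.coherent v x m h hvx hxm
  · intro v m h c hc
    rcases hmem v m h with ⟨-, rfl⟩ | ⟨hn, hm⟩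
    · rintro (rfl | hc')
      · exact hc.ne rfl
      · exact hzs (hs.closed _ _ hc' hc.isAncestor)
    · rintro (rfl | hc')
      · exact hn ((hs.mem_anc v m hm).trans hG hc.isAncestor)
      · exact hs.fresh v m hm c hc hc'
  · rintro (rfl | h)
    · exact ⟨rfl, rfl⟩
    · exact absurd h hg

theorem WellFormed.setPending {s : State V} (hs : WellFormed G r g s) (hg : g ∉ s.visited)
    {x u : V} (hx : s.mem x = some u) : WellFormed G r g { s with pending := some u } :=
  ⟨hs.closed, hs.mem_none, hs.mem_visited, hs.mem_anc, hs.coherent, hs.fresh, hs.mem_root, ⟨x, hx⟩,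
    fun h => absurd h hg⟩

theorem Callback.focus_eq {s : State V} {w q j : V} (h : Callback G r f D s w q j) :
    s.focus = s.cur := by
  simp [State.focus, h.pending]

theorem turn_of_callsBack (hG : G.IsTree) {s : State V} (hs : WellFormed G r g s)
    (hp : s.pending = none) {a q : V} (h : CallsBack G r f D s a q) : Turn G r f D s a q := by
  obtain ⟨ha, j, hj, -, -, hcj, ⟨hne, hcq, hact, hmin⟩, hl, hn⟩ := h
  have hf : s.focus = s.cur := by simp [State.focus, hp]
  have haS : a ∈ s.visited := hs.closed _ _ hs.cur_mem ha.1
  refine ⟨hf ▸ ha.1, ?_, hcq, (isActive_iff_of_isChild hG haS hcq).1 hact, ?_, ?_,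
    Or.inl ⟨j, hp, ha, hcj, hj, hne, hl, hn⟩⟩
  · rintro rfl
    exact hcj.not_isAncestor (hf ▸ hj)
  · rw [hf]
    exact fun h => hne (hcq.eq_of_isAncestor hG hcj h hj)
  · intro i hi hiu
    by_cases hij : i = j
    · subst hij; omega
    · exact hmin i hij hi ((isActive_iff_of_isChild hG haS hi).2 hiu)

theorem turn_of_backtrack (hG : G.IsTree) {s : State V} (hs : WellFormed G r g s) {u w q : V}
    (hp : s.pending = some u) (hu : ¬ ∃ c, IsChild G r u c)
    (hw : IsClosestActiveAncestor G r s.visited u w) (hq : IsLeastLoaded G r f D s.visited w q) :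
    Turn G r f D s w q := by
  have hf : s.focus = u := by simp [State.focus, hp]
  obtain ⟨hwu, hwa, hmax⟩ := hw
  obtain ⟨hcq, hqa, hmin⟩ := hq
  have hwS : w ∈ s.visited := hs.closed _ _ hs.focus_mem (hf.symm ▸ hwu)
  have key : ∀ x, HasUnvisited G r s.visited x → IsAncestor G r x u → IsAncestor G r x w :=
    fun x hx hxu => hxu.of_level_le hG hwu (hmax x hxu ((isActive_iff_of_mem hG
      (hs.closed _ _ hs.focus_mem (hf.symm ▸ hxu))).2 hx))
  have hqo := (isActive_iff_of_isChild hG hwS hcq).1 hqa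
  refine ⟨hf ▸ hwu, ?_, hcq, hqo, ?_, fun i hi hiu =>
    hmin i hi ((isActive_iff_of_isChild hG hwS hi).2 hiu), Or.inr ⟨by simp [hp], hf.symm ▸ key⟩⟩
  · rintro rfl
    exact hu ⟨q, hf ▸ hcq⟩
  · rw [hf]
    exact fun h => hcq.not_isAncestor (key q hqo h)

theorem Step.goal_notMem {s s' : State V} (hs : WellFormed G r g s)
    (h : Step G r g f D ⊤ s s') : g ∉ s.visited := by
  intro hg
  obtain ⟨h₁, h₂⟩ := hs.goal hg
  cases h with
  | callbackNew _ _ h => exact h.2.1 h₁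
  | callbackResume _ _ _ h => exact h.2.1 h₁
  | proceed h => exact h.2.1 h₁
  | backtrackNew _ _ _ h => simp [h] at h₂
  | backtrackResume _ _ _ _ h => simp [h] at h₂
  | descend _ _ h => simp [h] at h₂

theorem Step.move (hG : G.IsTree) {s s' : State V} (hs : WellFormed G r g s)
    (h : Step G r g f D ⊤ s s') : Move G r f D s s' := by
  cases h with
  | callbackNew a q h ha hq =>
    exact .turn a q (turn_of_callsBack hG hs h.1 ha) ((hs.mem_none q).1 hq)
  | callbackResume a q u h ha hq => exact .resume a q u (turn_of_callsBack hG hs h.1 ha) hq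
  | proceed h ha => exact .proceed h.1 ha
  | backtrackNew u w q h hu hw hq hm =>
    exact .turn w q (turn_of_backtrack hG hs h hu hw hq) ((hs.mem_none q).1 hm)
  | backtrackResume u w q u' h hu hw hq hm =>
    exact .resume w q u' (turn_of_backtrack hG hs h hu hw hq) hm
  | descend u x h hx hmin => exact .descend u x h hx hmin

theorem Turn.visits {s : State V} {w q : V} (h : Turn G r f D s w q) (hq : q ∉ s.visited) :
    Visits G r f D s w q :=
  ⟨h.anc, h.child, hq, h.leaves⟩

theorem WellFormed.visits_of_descend {s : State V} (hs : WellFormed G r g s) {u x : V}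
    (hp : s.pending = some u) (hx : IsChild G r u x) : Visits G r f D s s.focus x := by
  have hf : s.focus = u := by simp [State.focus, hp]
  exact ⟨.refl .., hf ▸ hx, hs.focus_fresh (hf ▸ hx), Or.inr ⟨by simp [hp], fun _ _ h => h⟩⟩

theorem WellFormed.visit_of_visits (hG : G.IsTree) {s : State V} (hs : WellFormed G r g s)
    (hg : g ∉ s.visited) {w z : V} (h : Visits G r f D s w z) :
    WellFormed G r g (s.visit G r z) :=
  hs.visit hG hg (hs.closed _ _ hs.focus_mem h.anc) h.child h.new

end TreeX

/-! ### Redirecting the search -/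

namespace TreeX

variable {V : Type*} {G : SimpleGraph V} {r g : V} {f : V → ℤ} {D : ℤ} {s s' : State V}

/-- Every subtree with unvisited nodes that the search has left was left by a callback: the node `y`
visited last in it is anchored at a node `a` above it, at least half of the visited nodes below the
child `j` of `a` are anchored at `a`, and no node below `j` has been visited since. -/
def ParkedByCallback (G : SimpleGraph V) (r : V) (f : V → ℤ) (D : ℤ) (s : State V) : Prop :=
  ∀ x y, HasUnvisited G r s.visited x → ¬ IsAncestor G r x s.focus → s.mem x = some y →
    ∃ a j, IsAnchor G r f D y a ∧ IsChild G r a j ∧ IsAncestor G r j x ∧ s.mem j = some y ∧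
      ¬ IsAncestor G r j s.focus ∧
      (visitedSubtree G r s.visited j).ncard ≤ 2 * load G r f D s.visited a j

/-- What moving the focus into the subtree of the child `q` of `w` changes, whether `q` is new or
the search below `q` is resumed. -/
structure Redirect (G : SimpleGraph V) (r : V) (f : V → ℤ) (D : ℤ) (s s' : State V) (w q : V) :
    Prop where
  anc : IsAncestor G r w s.focus
  child : IsChild G r w q
  leaves : Leaves G r f D s w q
  unvisited : HasUnvisited G r s.visited q
  off : ¬ IsAncestor G r q s.focus
  anc_focus : IsAncestor G r q s'.focus
  visited_sub : s.visited ⊆ s'.visited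
  subtree_eq : ∀ x, ¬ IsAncestor G r x s'.focus →
    visitedSubtree G r s'.visited x = visitedSubtree G r s.visited x
  mem_eq : ∀ x, ¬ IsAncestor G r x s'.focus → s'.mem x = s.mem x
  entered : ∀ k ∈ s.visited, ¬ IsAncestor G r k s.focus → IsAncestor G r k s'.focus →
    IsAncestor G r q k ∧ s.mem k = some s'.focus ∧ IsAnchor G r f D s'.focus w
  least : q ∈ s.visited → ∀ i, IsChild G r w i → HasUnvisited G r s.visited i →
    load G r f D s.visited w q ≤ load G r f D s.visited w i

/-- Where the search is resumed, it was suspended by a callback to the node at which it turns now.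
-/
theorem Turn.parked (hG : G.IsTree) (hP : ParkedByCallback G r f D s) {w q u : V}
    (h : Turn G r f D s w q) (hu : s.mem q = some u) :
    IsAnchor G r f D u w ∧
      (visitedSubtree G r s.visited q).ncard ≤ 2 * load G r f D s.visited w q := by
  obtain ⟨a, j, ha, hj, hjq, -, hjf, hn⟩ := hP q u h.unvisited h.off hu
  have hjq' : j = q := by
    by_contra hne
    exact hjf ((hjq.of_child hG h.child hne).trans hG h.anc)
  subst hjq'
  obtain rfl := hj.parent_unique hG h.child
  exact ⟨ha, hn⟩

theorem Turn.redirect (hG : G.IsTree) (hs : WellFormed G r g s)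
    (hP : ParkedByCallback G r f D s) {w q u : V} (h : Turn G r f D s w q) (hu : s.mem q = some u) :
    Redirect G r f D s { s with pending := some u } w q where
  anc := h.anc
  child := h.child
  leaves := h.leaves
  unvisited := h.unvisited
  off := h.off
  anc_focus := hs.mem_anc _ _ hu
  visited_sub := subset_rfl
  subtree_eq _ _ := rfl
  mem_eq _ _ := rfl
  entered k _ hkf hku := by
    have hku : IsAncestor G r k u := hku
    have hqk : IsAncestor G r q k := by
      rcases hku.total hG (hs.mem_anc _ _ hu) with h' | h'
      · by_cases hne : k = q
        · subst hne; exact h'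
        · exact absurd ((h'.of_child hG h.child hne).trans hG h.anc) hkf
      · exact h'
    exact ⟨hqk, hs.coherent q k u hu hqk hku, (h.parked hG hP hu).1⟩
  least _ := h.least

theorem Visits.redirect (hG : G.IsTree) (hs : WellFormed G r g s) {w z : V}
    (h : Visits G r f D s w z) : Redirect G r f D s (s.visit G r z) w z where
  anc := h.anc
  child := h.child
  leaves := h.leaves
  unvisited := .of_notMem h.new
  off h' := h.new (hs.closed _ _ hs.focus_mem h')
  anc_focus := .refl ..
  visited_sub := Set.subset_insert _ _
  subtree_eq x hx := by
    refine Set.Subset.antisymm ?_ (visitedSubtree_mono (Set.subset_insert _ _) x)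
    rintro u ⟨rfl | hu, hxu⟩
    · exact absurd hxu hx
    · exact ⟨hu, hxu⟩
  mem_eq x hx := visit_mem_of_not_isAncestor hx
  entered k hk hkf hkz := by
    refine absurd ((IsAncestor.of_child hG hkz h.child ?_).trans hG h.anc) hkf
    rintro rfl
    exact h.new hk
  least h' := absurd h' h.new

/-- The search only leaves a subtree with unvisited nodes by a callback to a node above it. -/
theorem Leaves.exists_callback (hG : G.IsTree) (hs : WellFormed G r g s) {w q x : V}
    (h : Leaves G r f D s w q) (hx : HasUnvisited G r s.visited x)
    (hxf : IsAncestor G r x s.focus) (hxw : ¬ IsAncestor G r x w) :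
    ∃ j, Callback G r f D s w q j ∧ IsAncestor G r j x ∧ s.mem x = some s.cur := by
  rcases h with ⟨j, hj⟩ | ⟨-, h⟩
  · rw [hj.focus_eq] at hxf
    refine ⟨j, hj, ?_, hs.mem_cur hxf⟩
    rcases hj.anc.total hG hxf with h' | h'
    · exact h'
    · by_cases hne : x = j
      · subst hne; exact h'
      · exact absurd (h'.of_child hG hj.child hne) hxw
  · exact absurd (h x hx hxf) hxw

theorem Redirect.not_isAncestor {w q : V} (hG : G.IsTree) (h : Redirect G r f D s s' w q) {x : V}
    (hx : ¬ IsAncestor G r x s'.focus) : ¬ IsAncestor G r x w :=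
  fun h' => hx ((h'.trans hG h.child.isAncestor).trans hG h.anc_focus)

theorem Redirect.callback_not_isAncestor {w q j : V} (hG : G.IsTree)
    (h : Redirect G r f D s s' w q) (hj : Callback G r f D s w q j) :
    ¬ IsAncestor G r j s'.focus :=
  fun h' => hj.ne (h.child.eq_of_isAncestor hG hj.child h.anc_focus h')

theorem ParkedByCallback.redirect (hG : G.IsTree) (hs : WellFormed G r g s)
    (hP : ParkedByCallback G r f D s) {w q : V} (h : Redirect G r f D s s' w q) :
    ParkedByCallback G r f D s' := by
  intro x y hx hxf hxy
  have hxw := h.not_isAncestor hG hxf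
  rw [h.mem_eq x hxf] at hxy
  replace hx := hx.anti h.visited_sub
  by_cases hxo : IsAncestor G r x s.focus
  · obtain ⟨j, hj, hjx, hxc⟩ := h.leaves.exists_callback hG hs hx hxo hxw
    have hjf := h.callback_not_isAncestor hG hj
    obtain rfl : s.cur = y := Option.some.inj (hxc.symm.trans hxy)
    refine ⟨w, j, hj.anchor, hj.child, hjx, ?_, hjf, ?_⟩
    · rw [h.mem_eq j hjf]; exact hs.mem_cur hj.anc
    · rw [load, h.subtree_eq j hjf]; exact hj.ncard_le
  · obtain ⟨a, j, ha, hj, hjx, hjm, hjf, hn⟩ := hP x y hx hxo hxy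
    have hjf' : ¬ IsAncestor G r j s'.focus := by
      intro hc
      obtain ⟨-, hm, -⟩ := h.entered j (hs.visited_of_mem hjm) hjf hc
      obtain rfl : y = s'.focus := Option.some.inj (hjm.symm.trans hm)
      exact hxf (hs.mem_anc _ _ hxy)
    refine ⟨a, j, ha, hj, hjx, ?_, hjf', ?_⟩
    · rw [h.mem_eq j hjf', hjm]
    · rw [load, h.subtree_eq j hjf']; exact hn

/-! ### Exhausted subtrees -/

/-- The nodes off the path to the goal whose subtree is exhausted and will not be searched again:
the focus is not there, and `mem` does not lead there from any node at which the search can turn.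
-/
def deadSet (G : SimpleGraph V) (r g : V) (s : State V) : Set V :=
  {x | ¬ IsAncestor G r x g ∧ ¬ HasUnvisited G r s.visited x ∧ ¬ IsAncestor G r x s.focus ∧
    ∀ v, HasUnvisited G r s.visited v → IsAncestor G r v x → ¬ IsAncestor G r v s.focus →
      ∀ m, s.mem v = some m → ¬ IsAncestor G r x m}

theorem deadSet_subset_of_redirect (hG : G.IsTree) (hs : WellFormed G r g s) {w q : V}
    (h : Redirect G r f D s s' w q) : deadSet G r g s ⊆ deadSet G r g s' := by
  rintro x ⟨hxg, hx, hxf, hd⟩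
  have hxs : x ∈ s.visited := by
    by_contra hc
    exact hx (.of_notMem hc)
  refine ⟨hxg, fun h' => hx (h'.anti h.visited_sub), fun hxf' => ?_, fun v hv hvx hvf m hm => ?_⟩
  · obtain ⟨hqx, -, -⟩ := h.entered x hxs hxf hxf'
    obtain ⟨-, hm, -⟩ := h.entered q (hs.closed _ _ hxs hqx) h.off h.anc_focus
    exact hd q h.unvisited hqx h.off _ hm hxf'
  · rw [h.mem_eq v hvf] at hm
    replace hv := hv.anti h.visited_sub
    by_cases hvo : IsAncestor G r v s.focus
    · obtain ⟨j, hj, -, hc⟩ := h.leaves.exists_callback hG hs hv hvo (h.not_isAncestor hG hvf)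
      obtain rfl : s.cur = m := Option.some.inj (hc.symm.trans hm)
      rwa [← hj.focus_eq]
    · exact hd v hv hvx hvo m hm

/-- When the search leaves an exhausted part of the tree, that part becomes dead. -/
theorem ncard_deadSet_add_dist_le [Finite V] (hG : G.IsTree) (hs : WellFormed G r g s)
    (hg : g ∉ s.visited) {w q : V} (h : Redirect G r f D s s' w q)
    (hl : ∀ x, HasUnvisited G r s.visited x → IsAncestor G r x s.focus → IsAncestor G r x w) :
    (deadSet G r g s).ncard + G.dist w s.focus ≤ (deadSet G r g s').ncard := by
  set P : Set V := {x | IsAncestor G r x s.focus ∧ ¬ IsAncestor G r x w} with hPdef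
  have hP : P.ncard = G.dist w s.focus := by
    have h₁ := h.anc.ncard_between hG
    have h₂ : {x | IsAncestor G r w x ∧ IsAncestor G r x s.focus} = insert w P := by
      ext x
      constructor
      · rintro ⟨hwx, hxf⟩
        by_cases hxw : IsAncestor G r x w
        · exact Or.inl (hxw.antisymm hG hwx)
        · exact Or.inr ⟨hxf, hxw⟩
      · rintro (rfl | ⟨hxf, hxw⟩)
        · exact ⟨.refl .., h.anc⟩
        · exact ⟨(hxf.total hG h.anc).resolve_left hxw, hxf⟩
    rw [h₂, Set.ncard_insert_of_notMem (fun h => h.2 (.refl ..)) (Set.toFinite _)] at h₁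
    omega
  have hdisj : Disjoint (deadSet G r g s) P :=
    Set.disjoint_left.2 fun x hx hx' => hx.2.2.1 hx'.1
  have hsub : deadSet G r g s ∪ P ⊆ deadSet G r g s' := by
    refine Set.union_subset (deadSet_subset_of_redirect hG hs h) ?_
    rintro x ⟨hxf, hxw⟩
    have hx : ¬ HasUnvisited G r s.visited x := fun h' => hxw (hl x h' hxf)
    refine ⟨fun hxg => hx ⟨g, hxg, hg⟩, fun h' => hx (h'.anti h.visited_sub), fun hxf' => ?_,
      fun v hv hvx hvf => ?_⟩
    · rcases hxf'.total hG h.anc_focus with h' | h'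
      · by_cases hne : x = q
        · subst hne; exact hx h.unvisited
        · exact hxw (h'.of_child hG h.child hne)
      · exact h.off (h'.trans hG hxf)
    · exact absurd (hl v (hv.anti h.visited_sub) (hvx.trans hG hxf)) (h.not_isAncestor hG hvf)
  rw [← hP, ← Set.ncard_union_eq hdisj (Set.toFinite _) (Set.toFinite _)]
  exact Set.ncard_le_ncard hsub (Set.toFinite _)

/-! ### The ledger of callbacks -/

/-- The search below the child `k` of `a` is suspended at a node anchored at `a`. -/
def IsSuspended (G : SimpleGraph V) (r : V) (f : V → ℤ) (D : ℤ) (s : State V) (a k : V) : Prop :=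
  ¬ IsAncestor G r k s.focus ∧ ∃ y, s.mem k = some y ∧ IsAnchor G r f D y a

/-- A ledger `L` assigns to the child `k` of `a` the cost of leaving the subtree of `k` by
callbacks to `a` and of resuming the search there. Between two such callbacks the load of `k` at
least doubles, because `k` is least loaded when the search below it is resumed; hence the geometric
bounds. -/
structure IsLedger (G : SimpleGraph V) (r : V) (f : V → ℤ) (D : ℤ) (s : State V) (L : V → ℕ) :
    Prop where
  root : L r = 0
  le_load : ∀ a k, IsChild G r a k → L k ≤ 8 * load G r f D s.visited a k
  le_of_suspended : ∀ a k, IsChild G r a k → HasUnvisited G r s.visited k →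
    IsSuspended G r f D s a k → L k ≤ 6 * load G r f D s.visited a k
  le_sibling : ∀ a k, IsChild G r a k → ¬ IsSuspended G r f D s a k →
    ∀ i, IsChild G r a i → i ≠ k → HasUnvisited G r s.visited i →
      L k ≤ 8 * load G r f D s.visited a i

open Classical in
/-- The charges for a turn at `w` towards `q`: twice the load of the child of `w` that is left by a
callback, and twice the load of `q` if the search below `q` is resumed. -/
noncomputable def charge (G : SimpleGraph V) (r : V) (f : V → ℤ) (D : ℤ) (s : State V) (w q k : V) :
    ℕ :=
  (if Callback G r f D s w q k then 2 * load G r f D s.visited w k else 0) +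
    if k = q ∧ q ∈ s.visited then 2 * load G r f D s.visited w q else 0

theorem IsLedger.redirect [Finite V] (hG : G.IsTree) (hs : WellFormed G r g s) {L : V → ℕ}
    (hL : IsLedger G r f D s L) {w q : V} (h : Redirect G r f D s s' w q) :
    IsLedger G r f D s' (fun k => L k + charge G r f D s w q k) := by
  have hmono : ∀ a k, load G r f D s.visited a k ≤ load G r f D s'.visited a k :=
    load_mono h.visited_sub
  have main : ∀ a k, IsChild G r a k →
      L k + charge G r f D s w q k ≤ 8 * load G r f D s'.visited a k ∧
      (HasUnvisited G r s'.visited k → IsSuspended G r f D s' a k →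
        L k + charge G r f D s w q k ≤ 6 * load G r f D s'.visited a k) ∧
      (¬ IsSuspended G r f D s' a k → ∀ i, IsChild G r a i → i ≠ k →
        HasUnvisited G r s'.visited i →
        L k + charge G r f D s w q k ≤ 8 * load G r f D s'.visited a i) := by
    intro a k hak
    by_cases hc : Callback G r f D s w q k
    · obtain rfl := hc.child.parent_unique hG hak
      have hns : ¬ IsSuspended G r f D s w k := fun h' => h'.1 (hc.focus_eq ▸ hc.anc)
      have h₁ := hL.le_sibling w k hak hns q h.child hc.ne h.unvisited
      have h₂ := hc.load_le
      have hkf := h.callback_not_isAncestor hG hc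
      have h₃ : charge G r f D s w q k = 2 * load G r f D s.visited w k := by
        simp [charge, hc, hc.ne.symm]
      have h₄ := hmono w k
      refine ⟨by omega, fun _ _ => by omega, fun h' => absurd ?_ h'⟩
      exact ⟨hkf, s.cur, by rw [h.mem_eq k hkf, hs.mem_cur hc.anc], hc.anchor⟩
    by_cases hq : k = q ∧ q ∈ s.visited
    · obtain ⟨rfl, hk⟩ := hq
      obtain rfl := h.child.parent_unique hG hak
      obtain ⟨-, hm, ha⟩ := h.entered k hk h.off h.anc_focus
      have h₁ := hL.le_of_suspended w k hak h.unvisited ⟨h.off, _, hm, ha⟩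
      have h₂ : charge G r f D s w k k = 2 * load G r f D s.visited w k := by
        simp [charge, hc, hk]
      have h₃ := hmono w k
      refine ⟨by omega, fun _ h' => absurd h.anc_focus h'.1, fun _ i hi _ hiu => ?_⟩
      have h₄ := h.least hk i hi (hiu.anti h.visited_sub)
      have h₅ := hmono w i
      omega
    have h₀ : charge G r f D s w q k = 0 := by simp [charge, hc, hq]
    rw [h₀, add_zero]
    refine ⟨(hL.le_load a k hak).trans (by gcongr; exact hmono a k),
      fun hku ⟨hkf, y, hy, hya⟩ => ?_, fun hns i hi hik hiu => ?_⟩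
    · replace hku := hku.anti h.visited_sub
      rw [h.mem_eq k hkf] at hy
      by_cases hko : IsAncestor G r k s.focus
      · obtain ⟨j, hj, -, hkc⟩ := h.leaves.exists_callback hG hs hku hko (h.not_isAncestor hG hkf)
        obtain rfl : s.cur = y := Option.some.inj (hkc.symm.trans hy)
        obtain rfl := hya.unique hG hj.anchor
        obtain rfl := hak.eq_of_isAncestor hG hj.child (hj.focus_eq ▸ hko) hj.anc
        exact absurd hj hc
      · exact (hL.le_of_suspended a k hak hku ⟨hko, y, hy, hya⟩).trans (by gcongr; exact hmono a k)
    · by_cases hsu : IsSuspended G r f D s a k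
      · obtain ⟨hko, y, hy, hya⟩ := hsu
        have hkf : IsAncestor G r k s'.focus := by
          by_contra hkf
          exact hns ⟨hkf, y, by rw [h.mem_eq k hkf, hy], hya⟩
        obtain ⟨hqk, hm, hw⟩ := h.entered k (hs.visited_of_mem hy) hko hkf
        obtain rfl : y = s'.focus := Option.some.inj (hy.symm.trans hm)
        obtain rfl := hya.unique hG hw
        obtain rfl := hak.eq_of_isAncestor hG h.child hkf h.anc_focus
        exact absurd ⟨rfl, hs.visited_of_mem hy⟩ hq
      · exact (hL.le_sibling a k hak hsu i hi hik (hiu.anti h.visited_sub)).trans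
          (by gcongr; exact hmono a i)
  refine ⟨?_, fun a k hk => (main a k hk).1, fun a k hk => (main a k hk).2.1,
    fun a k hk => (main a k hk).2.2⟩
  have h₁ : ¬ Callback G r f D s w q r := fun h' => h'.child.ne_root rfl
  have h₂ : ¬ (r = q ∧ q ∈ s.visited) := fun h' => h.child.ne_root h'.1.symm
  simp [charge, h₁, h₂, hL.root]

/-- The invariant that bounds the movement cost. The distance to the focus is a cost to be paid at
the next visit. -/
def CostBounded [Fintype V] (G : SimpleGraph V) (r g : V) (f : V → ℤ) (D : ℤ) (s : State V) :
    Prop :=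
  ∃ L, IsLedger G r f D s L ∧ s.cost + G.dist s.cur s.focus + 1 ≤
    s.visited.ncard + (deadSet G r g s).ncard + ∑ k, L k

open Classical in
/-- Going up from the focus to `w` is paid by dead nodes or by the ledger. -/
theorem Redirect.dist_up_le [Fintype V] (hG : G.IsTree) (hs : WellFormed G r g s)
    (hg : g ∉ s.visited) {w q : V} (h : Redirect G r f D s s' w q) :
    (deadSet G r g s).ncard + G.dist s.focus w +
        (if q ∈ s.visited then 2 * load G r f D s.visited w q else 0) ≤
      (deadSet G r g s').ncard + ∑ k, charge G r f D s w q k := by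
  rw [SimpleGraph.dist_comm]
  have hq : (if q ∈ s.visited then 2 * load G r f D s.visited w q else 0) ≤
      charge G r f D s w q q := by
    by_cases hq : q ∈ s.visited <;> simp [charge, hq]
  rcases h.leaves with ⟨j, hj⟩ | ⟨-, hl⟩
  · have h₁ := Set.ncard_le_ncard (deadSet_subset_of_redirect hG hs h) (Set.toFinite _)
    have h₂ := dist_le_ncard_visitedSubtree hG hs.closed hj.child hs.cur_mem hj.anc
    have h₃ := hj.ncard_le
    have h₄ : 2 * load G r f D s.visited w j ≤ charge G r f D s w q j := by
      simp [charge, hj]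
    have h₅ : charge G r f D s w q j + charge G r f D s w q q ≤ ∑ k, charge G r f D s w q k := by
      rw [← Finset.sum_pair hj.ne.symm]
      exact Finset.sum_le_sum_of_subset (Finset.subset_univ _)
    rw [hj.focus_eq]
    omega
  · have h₁ := ncard_deadSet_add_dist_le hG hs hg h hl
    have h₂ : charge G r f D s w q q ≤ ∑ k, charge G r f D s w q k :=
      Finset.single_le_sum (fun _ _ => Nat.zero_le _) (Finset.mem_univ q)
    omega

open Classical in
theorem CostBounded.redirect [Fintype V] (hG : G.IsTree) (hs : WellFormed G r g s)
    (hg : g ∉ s.visited) (hC : CostBounded G r g f D s) {w q : V} (h : Redirect G r f D s s' w q)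
    (hcost : s'.cost + G.dist s'.cur s'.focus = s.cost + G.dist s.cur s'.focus)
    (hdown : s.visited.ncard + G.dist w s'.focus ≤ s'.visited.ncard +
      if q ∈ s.visited then 2 * load G r f D s.visited w q else 0) :
    CostBounded G r g f D s' := by
  obtain ⟨L, hL, hle⟩ := hC
  refine ⟨_, hL.redirect hG hs h, ?_⟩
  have h₁ := h.dist_up_le hG hs hg
  have h₂ := hG.connected.dist_triangle (u := s.cur) (v := s.focus) (w := s'.focus)
  have h₃ := hG.connected.dist_triangle (u := s.focus) (v := w) (w := s'.focus)
  rw [Finset.sum_add_distrib]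
  omega

theorem CostBounded.visit [Fintype V] (hG : G.IsTree) (hs : WellFormed G r g s)
    (hg : g ∉ s.visited) (hC : CostBounded G r g f D s) {w z : V} (h : Visits G r f D s w z) :
    CostBounded G r g f D (s.visit G r z) := by
  refine hC.redirect hG hs hg (h.redirect hG hs) ?_ ?_
  · simp [State.visit, State.focus]
  · have h₁ : (s.visit G r z).visited.ncard = s.visited.ncard + 1 :=
      Set.ncard_insert_of_notMem h.new (Set.toFinite _)
    have h₂ : G.dist w (s.visit G r z).focus = 1 := SimpleGraph.dist_eq_one_iff_adj.2 h.child.1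
    omega

theorem CostBounded.resume [Fintype V] (hG : G.IsTree) (hs : WellFormed G r g s)
    (hP : ParkedByCallback G r f D s) (hg : g ∉ s.visited) (hC : CostBounded G r g f D s)
    {w q u : V} (h : Turn G r f D s w q) (hu : s.mem q = some u) :
    CostBounded G r g f D { s with pending := some u } := by
  refine hC.redirect hG hs hg (h.redirect hG hs hP hu) rfl ?_
  rw [if_pos (hs.visited_of_mem hu)]
  gcongr
  exact (dist_le_ncard_visitedSubtree hG hs.closed h.child (hs.mem_visited _ _ hu)
    (hs.mem_anc _ _ hu)).trans (h.parked hG hP hu).2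

end TreeX

/-! ### Visits off the path to the goal -/

namespace TreeX

variable {V : Type*} {G : SimpleGraph V} {r g : V} {f : V → ℤ} {D : ℤ} {s s' : State V}

/-- At the proper ancestor `h` of the goal, the child `c` is off the path to the goal and the child
`p` is on it. -/
structure Branch (G : SimpleGraph V) (r g h c p : V) : Prop where
  child : IsChild G r h c
  off : ¬ IsAncestor G r c g
  childOn : IsChild G r h p
  on : IsAncestor G r p g

/-- The visited erroneous nodes of the subtree at `c`. -/
def visitedErrors (G : SimpleGraph V) (r g : V) (f : V → ℤ) (S : Set V) (c : V) : Set V :=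
  {u | u ∈ visitedSubtree G r S c ∧ u ∈ erroneous G g f}

namespace Branch

variable {h c p : V}

theorem anc (hB : Branch G r g h c p) (hG : G.IsTree) : IsAncestor G r h g :=
  hB.childOn.isAncestor.trans hG hB.on

theorem ne (hB : Branch G r g h c p) : p ≠ c := by
  rintro rfl
  exact hB.off hB.on

theorem isAnchor (hB : Branch G r g h c p) (hG : G.IsTree) (hD : D = G.dist r g) {u : V}
    (hu : IsAncestor G r c u) (hc : u ∉ erroneous G g f) : IsAnchor G r f D u h :=
  isAnchor_of_correct hG hD (hB.anc hG) hB.child hB.off hu (not_not.1 hc)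

theorem ncard_le [Finite V] (hB : Branch G r g h c p) (hG : G.IsTree) (hD : D = G.dist r g)
    (S : Set V) : (visitedSubtree G r S c).ncard ≤
      (visitedErrors G r g f S c).ncard + load G r f D S h c := by
  refine le_trans (Set.ncard_le_ncard ?_ (Set.toFinite _)) (Set.ncard_union_le _ _)
  intro u hu
  by_cases he : u ∈ erroneous G g f
  · exact Or.inl ⟨hu, he⟩
  · exact Or.inr ⟨hu, hB.isAnchor hG hD hu.2 he⟩

end Branch

/-- The next visit of a node below `c` can be charged to the previous one, which is erroneous, or
the number of visited nodes below `c` is small. -/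
def Chargeable (G : SimpleGraph V) (r g : V) (f : V → ℤ) (D : ℤ) (s : State V) (h c p : V) : Prop :=
  ∀ y, s.mem c = some y → y ∈ erroneous G g f ∨
    (visitedSubtree G r s.visited c).ncard ≤
      2 * (visitedErrors G r g f s.visited c).ncard + 2 * load G r f D s.visited h p

/-- When the search goes on below an off-path node `c`, the next visit there is chargeable. -/
def PendingChargeable (G : SimpleGraph V) (r g : V) (f : V → ℤ) (D : ℤ) (s : State V) : Prop :=
  s.pending ≠ none → ∀ h c p, Branch G r g h c p → HasUnvisited G r s.visited c →
    IsAncestor G r c s.focus → Chargeable G r g f D s h c p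

/-- The bound on the number of visited nodes below an off-path child `c` of a node `h` of the path.
It is stronger by one while the node visited last below `c` is erroneous, since that node pays for
the next visit. -/
def OffPathBounded (G : SimpleGraph V) (r g : V) (f : V → ℤ) (D : ℤ) (s : State V) : Prop :=
  ∀ h c p, Branch G r g h c p → ∀ y, s.mem c = some y →
    (visitedSubtree G r s.visited c).ncard ≤
      3 * (visitedErrors G r g f s.visited c).ncard + 2 * load G r f D s.visited h p + 1 ∧
    (y ∈ erroneous G g f → (visitedSubtree G r s.visited c).ncard ≤
      3 * (visitedErrors G r g f s.visited c).ncard + 2 * load G r f D s.visited h p)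

/-- A node of the path below which off-path nodes have been visited is witnessed by an error: one
of its children is erroneous, or a visited (hence erroneous) node below its child on the path is
anchored at it. -/
def DetoursWitnessed (G : SimpleGraph V) (r g : V) (f : V → ℤ) (D : ℤ) (s : State V) : Prop :=
  ∀ h c p, Branch G r g h c p → c ∈ s.visited →
    (∃ e, IsChild G r h e ∧ e ∈ erroneous G g f) ∨
      ∃ u ∈ s.visited, IsAncestor G r p u ∧ IsAnchor G r f D u h

theorem chargeable_of_isAncestor_turn (hG : G.IsTree) (hD : D = G.dist r g)
    (hs : WellFormed G r g s) (hP : PendingChargeable G r g f D s) {w q h c p : V}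
    (hw : IsAncestor G r w s.focus) (hl : Leaves G r f D s w q) (hB : Branch G r g h c p)
    (hcw : IsAncestor G r c w) (hc : HasUnvisited G r s.visited c) :
    Chargeable G r g f D s h c p := by
  rcases hl with ⟨j, hj⟩ | ⟨hp, -⟩
  · intro y hy
    rw [hj.focus_eq] at hw
    have hcc := hcw.trans hG hw
    obtain rfl : s.cur = y := Option.some.inj ((hs.mem_cur hcc).symm.trans hy)
    left
    by_contra he
    obtain rfl := (hB.isAnchor hG hD hcc he).unique hG hj.anchor
    exact hB.child.not_isAncestor hcw
  · exact hP hp h c p hB hc (hcw.trans hG hw)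

theorem exists_isLeastLoadedExcept [Finite V] {S : Set V} {h c p : V} (hp : IsChild G r h p)
    (hpa : IsActive G r S p) (hne : p ≠ c) : ∃ q, IsLeastLoadedExcept G r f D S h c q := by
  obtain ⟨q, ⟨hq₁, hq₂, hq₃⟩, hmin⟩ := Set.exists_min_image
    {i | i ≠ c ∧ IsChild G r h i ∧ IsActive G r S i} (load G r f D S h) (Set.toFinite _)
    ⟨p, hne, hp, hpa⟩
  exact ⟨q, hq₁, hq₂, hq₃, fun i h₁ h₂ h₃ => hmin i ⟨h₁, h₂, h₃⟩⟩

/-- Going on below `c` at a correct node, anchored at `h`, means that `h` is not critical. -/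
theorem PendingChargeable.proceed [Finite V] (hG : G.IsTree) (hD : D = G.dist r g)
    (hs : WellFormed G r g s) (hg : g ∉ s.visited) (hn : ¬ ∃ a q, CallsBack G r f D s a q) :
    PendingChargeable G r g f D { s with pending := some s.cur } := by
  intro _ h c p hB hc hcc y hy
  replace hcc : IsAncestor G r c s.cur := hcc
  replace hy : s.mem c = some y := hy
  replace hc : HasUnvisited G r s.visited c := hc
  obtain rfl : s.cur = y := Option.some.inj ((hs.mem_cur hcc).symm.trans hy)
  by_contra! hcon
  obtain ⟨he, hlt⟩ := hcon
  change _ < (visitedSubtree G r s.visited c).ncard at hlt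
  have hanch := hB.isAnchor hG hD hcc he
  have hh : h ∈ s.visited := hs.closed _ _ hs.cur_mem hanch.1
  have hpa := (isActive_iff_of_isChild hG hh hB.childOn).2 ⟨g, hB.on, hg⟩
  have hca := (isActive_iff_of_isChild hG hh hB.child).2 hc
  obtain ⟨q, hq⟩ := exists_isLeastLoadedExcept (f := f) (D := D) hB.childOn hpa hB.ne
  have h₁ := hq.2.2.2 p hB.ne hB.childOn hpa
  have h₂ := hB.ncard_le hG hD (f := f) s.visited
  refine hn ⟨h, q, hanch, c, hcc, (isActive_iff_of_mem hG hh).2 ⟨g, hB.anc hG, hg⟩, ?_, hB.child,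
    hq, by dsimp only at hlt; omega, by dsimp only at hlt; omega⟩
  rintro ⟨-, x, -, hx⟩
  exact hB.ne ((hx p ⟨hB.childOn, hpa⟩).trans (hx c ⟨hB.child, hca⟩).symm)

theorem PendingChargeable.resume [Finite V] (hG : G.IsTree) (hD : D = G.dist r g)
    (hs : WellFormed G r g s) (hg : g ∉ s.visited) (hK : ParkedByCallback G r f D s)
    (hP : PendingChargeable G r g f D s) {w q u : V} (ht : Turn G r f D s w q)
    (hu : s.mem q = some u) : PendingChargeable G r g f D { s with pending := some u } := by
  intro _ h c p hB hc hcu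
  change Chargeable G r g f D s h c p
  replace hcu : IsAncestor G r c u := hcu
  replace hc : HasUnvisited G r s.visited c := hc
  by_cases hcq : c = q
  · subst hcq
    obtain rfl := hB.child.parent_unique hG ht.child
    intro y _
    right
    have h₁ := hB.ncard_le hG hD (f := f) s.visited
    have h₂ := ht.least p hB.childOn ⟨g, hB.on, hg⟩
    omega
  rcases hcu.total hG (hs.mem_anc _ _ hu) with h' | h'
  · exact chargeable_of_isAncestor_turn hG hD hs hP ht.anc ht.leaves hB
      (h'.of_child hG ht.child hcq) hc
  · intro y hy
    left
    by_contra he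
    obtain ⟨-, hm, ha⟩ := (ht.redirect hG hs hK hu).entered c (hs.visited_of_mem hy)
      (fun h'' => ht.off (h'.trans hG h'')) hcu
    obtain rfl : y = u := Option.some.inj (hy.symm.trans hm)
    obtain rfl := (hB.isAnchor hG hD hcu he).unique hG ha
    exact ht.child.not_isAncestor (h'.of_child hG hB.child (Ne.symm hcq))

theorem visitedSubtree_insert_of_isAncestor {S : Set V} {c z : V} (h : IsAncestor G r c z) :
    visitedSubtree G r (insert z S) c = insert z (visitedSubtree G r S c) := by
  ext u
  constructor
  · rintro ⟨rfl | hu, hcu⟩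
    · exact Or.inl rfl
    · exact Or.inr ⟨hu, hcu⟩
  · rintro (rfl | ⟨hu, hcu⟩)
    · exact ⟨Or.inl rfl, h⟩
    · exact ⟨Or.inr hu, hcu⟩

theorem visitedErrors_mono {S S' : Set V} (h : S ⊆ S') (c : V) :
    visitedErrors G r g f S c ⊆ visitedErrors G r g f S' c :=
  fun _ hu => ⟨visitedSubtree_mono h c hu.1, hu.2⟩

theorem OffPathBounded.visit [Finite V] (hG : G.IsTree) (hD : D = G.dist r g)
    (hs : WellFormed G r g s) (hP : PendingChargeable G r g f D s)
    (hO : OffPathBounded G r g f D s) {w z : V} (hz : Visits G r f D s w z) :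
    OffPathBounded G r g f D (s.visit G r z) := by
  intro h c p hB y hy
  have hsub : s.visited ⊆ insert z s.visited := Set.subset_insert _ _
  have hσ := load_mono (G := G) (r := r) (f := f) (D := D) hsub h p
  change _ ≤ load G r f D (s.visit G r z).visited h p at hσ
  by_cases hcz : IsAncestor G r c z
  · have hn : (visitedSubtree G r (s.visit G r z).visited c).ncard =
        (visitedSubtree G r s.visited c).ncard + 1 := by
      rw [State.visit, visitedSubtree_insert_of_isAncestor hcz,
        Set.ncard_insert_of_notMem (fun h' => hz.new h'.1) (Set.toFinite _)]
    have he := Set.ncard_le_ncard (visitedErrors_mono (G := G) (r := r) (g := g) (f := f) hsub c)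
      (Set.toFinite _)
    change _ ≤ (visitedErrors G r g f (s.visit G r z).visited c).ncard at he
    have he' : z ∈ erroneous G g f → (visitedErrors G r g f s.visited c).ncard + 1 ≤
        (visitedErrors G r g f (s.visit G r z).visited c).ncard := by
      intro hze
      rw [← Set.ncard_insert_of_notMem (fun h' => hz.new h'.1.1) (Set.toFinite _)]
      refine Set.ncard_le_ncard (Set.insert_subset ⟨⟨Or.inl rfl, hcz⟩, hze⟩
        (visitedErrors_mono hsub c)) (Set.toFinite _)
    have hy' : y = z := by
      rw [visit_mem_of_isAncestor hcz] at hy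
      exact (Option.some.inj hy).symm
    -- The bound before the visit of `z`: the previous visit below `c` pays for this one.
    have hbefore : (visitedSubtree G r s.visited c).ncard ≤
        3 * (visitedErrors G r g f s.visited c).ncard + 2 * load G r f D s.visited h p := by
      by_cases hc : c = z
      · subst hc
        have : visitedSubtree G r s.visited c = ∅ := by
          ext u
          simp only [Set.mem_empty_iff_false, iff_false]
          exact fun hu => hz.new (hs.closed _ _ hu.1 hu.2)
        rw [this]; simp
      · have hcw := hcz.of_child hG hz.child hc
        obtain ⟨m, hm⟩ := hs.mem_eq_some (hs.closed _ _ (hs.closed _ _ hs.focus_mem hz.anc) hcw)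
        rcases chargeable_of_isAncestor_turn hG hD hs hP hz.anc hz.leaves hB hcw
          ⟨z, hcz, hz.new⟩ m hm with h' | h'
        · exact (hO h c p hB m hm).2 h'
        · omega
    subst hy'
    exact ⟨by omega, fun hye => by have := he' hye; omega⟩
  · have hst : visitedSubtree G r (s.visit G r z).visited c = visitedSubtree G r s.visited c :=
      (hz.redirect hG hs).subtree_eq c hcz
    rw [visit_mem_of_not_isAncestor hcz] at hy
    obtain ⟨h₁, h₂⟩ := hO h c p hB y hy
    rw [visitedErrors, hst]
    exact ⟨by unfold visitedErrors at h₁; omega,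
      fun hye => by have := h₂ hye; unfold visitedErrors at this; omega⟩

theorem DetoursWitnessed.mono (hW : DetoursWitnessed G r g f D s) {S : Set V}
    (hS : s.visited ⊆ S) {h c p : V} (hB : Branch G r g h c p) (hc : c ∈ s.visited) :
    (∃ e, IsChild G r h e ∧ e ∈ erroneous G g f) ∨
      ∃ u ∈ S, IsAncestor G r p u ∧ IsAnchor G r f D u h :=
  (hW h c p hB hc).imp_right fun ⟨u, hu, hu'⟩ => ⟨u, hS hu, hu'⟩

theorem DetoursWitnessed.descend (hW : DetoursWitnessed G r g f D s) (hG : G.IsTree) {u x : V}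
    (hx : IsChild G r u x) (hmin : ∀ c, IsChild G r u c → f x ≤ f c) :
    DetoursWitnessed G r g f D (s.visit G r x) := by
  rintro h c p hB (rfl | hc)
  · obtain rfl := hx.parent_unique hG hB.child
    left
    by_contra! hcon
    have h₁ : f c = G.dist c g := not_not.1 (hcon c hx)
    have h₂ : f p = G.dist p g := not_not.1 (hcon p hB.childOn)
    have h₃ := hmin p hB.childOn
    have h₄ := hB.child.dist_add_dist hG (.refl ..) hB.off
    have h₅ := hB.on.level_add_dist
    have h₆ := (hB.anc hG).level_add_dist
    have h₇ := hB.childOn.2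
    omega
  · exact hW.mono (Set.subset_insert _ _) hB hc

theorem DetoursWitnessed.turn (hW : DetoursWitnessed G r g f D s) (hG : G.IsTree)
    (hs : WellFormed G r g s) (hg : g ∉ s.visited) {w q : V} (ht : Turn G r f D s w q) :
    DetoursWitnessed G r g f D (s.visit G r q) := by
  rintro h c p hB (rfl | hc)
  · obtain rfl := ht.child.parent_unique hG hB.child
    -- The search comes from another child of `w`: off the path, or the child `p` on it.
    have key : ∀ i, IsChild G r w i → ¬ IsAncestor G r i g → IsAncestor G r i s.focus →
        (∃ e, IsChild G r w e ∧ e ∈ erroneous G g f) ∨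
          ∃ u ∈ insert c s.visited, IsAncestor G r p u ∧ IsAnchor G r f D u w :=
      fun i hi hig hif => hW.mono (Set.subset_insert _ _) ⟨hi, hig, hB.childOn, hB.on⟩
        (hs.closed _ _ hs.focus_mem hif)
    rcases ht.leaves with ⟨j, hj⟩ | ⟨-, hl⟩
    · by_cases hjg : IsAncestor G r j g
      · obtain rfl := hj.child.eq_of_isAncestor hG hB.childOn hjg hB.on
        exact Or.inr ⟨s.cur, Or.inr hs.cur_mem, hj.anc, hj.anchor⟩
      · exact key j hj.child hjg (hj.focus_eq ▸ hj.anc)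
    · obtain ⟨i, hi, hif⟩ := ht.anc.exists_child hG ht.ne
      refine key i hi (fun hig => hi.not_isAncestor (hl i ⟨g, hig, hg⟩ hif)) hif
  · exact hW.mono (Set.subset_insert _ _) hB hc

/-! ### The invariant -/

/-- The invariant of the program. -/
structure Invariant [Fintype V] (G : SimpleGraph V) (r g : V) (f : V → ℤ) (D : ℤ) (s : State V) :
    Prop where
  wf : WellFormed G r g s
  parked : ParkedByCallback G r f D s
  cost : CostBounded G r g f D s
  pending : PendingChargeable G r g f D s
  offPath : OffPathBounded G r g f D s
  detours : DetoursWitnessed G r g f D s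

theorem invariant_init [Fintype V] (hG : G.IsTree) : Invariant G r g f D (init r) := by
  have hmem : ∀ v m, (init r).mem v = some m → v = r := by
    intro v m h
    simp only [init] at h
    split_ifs at h with hv
    exact hv
  refine ⟨wellFormed_init hG r g, fun x y _ hx hy => ?_, ⟨fun _ => 0, ⟨rfl, ?_, ?_, ?_⟩, ?_⟩,
    fun h => absurd rfl h, fun h c p hB y hy => ?_, ?_⟩
  · obtain rfl := hmem x y hy
    exact absurd (isAncestor_root ..) hx
  · intros; simp
  · intros; simp
  · intros; simp
  · simp [init, State.focus]
  · exact absurd (hmem c y hy) hB.child.ne_root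
  · rintro h c p hB rfl
    exact absurd rfl hB.child.ne_root

theorem Invariant.visit [Fintype V] (hG : G.IsTree) (hD : D = G.dist r g)
    (hI : Invariant G r g f D s) (hg : g ∉ s.visited) {w z : V} (h : Visits G r f D s w z)
    (hW : DetoursWitnessed G r g f D (s.visit G r z)) : Invariant G r g f D (s.visit G r z) :=
  ⟨hI.wf.visit_of_visits hG hg h, hI.parked.redirect hG hI.wf (h.redirect hG hI.wf),
    hI.cost.visit hG hI.wf hg h, fun h => absurd rfl h,
    hI.offPath.visit hG hD hI.wf hI.pending h, hW⟩

theorem Invariant.step [Fintype V] (hG : G.IsTree) (hD : D = G.dist r g)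
    (hI : Invariant G r g f D s) (h : Step G r g f D ⊤ s s') : Invariant G r g f D s' := by
  have hg := h.goal_notMem hI.wf
  cases h.move hG hI.wf with
  | proceed hp hn =>
    have hf : s.focus = s.cur := by simp [State.focus, hp]
    have hf' : ({ s with pending := some s.cur } : State V).focus = s.focus := hf.symm
    refine ⟨hI.wf.setPending hg hI.wf.mem_root, ?_, ?_,
      PendingChargeable.proceed hG hD hI.wf hg hn, hI.offPath, hI.detours⟩
    · unfold ParkedByCallback; rw [hf']; exact hI.parked
    · obtain ⟨L, hL, hle⟩ := hI.cost
      refine ⟨L, ⟨hL.root, hL.le_load, ?_, ?_⟩, ?_⟩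
      · unfold IsSuspended; rw [hf']; exact hL.le_of_suspended
      · unfold IsSuspended; rw [hf']; exact hL.le_sibling
      · unfold deadSet; rw [hf']; exact hle
  | descend u x hp hx hmin =>
    exact hI.visit hG hD hg (hI.wf.visits_of_descend hp hx) (hI.detours.descend hG hx hmin)
  | turn w q ht hq =>
    exact hI.visit hG hD hg (ht.visits hq) (hI.detours.turn hG hI.wf hg ht)
  | resume w q u ht hu =>
    exact ⟨hI.wf.setPending hg hu, hI.parked.redirect hG hI.wf (ht.redirect hG hI.wf hI.parked hu),
      hI.cost.resume hG hI.wf hI.parked hg ht hu,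
      hI.pending.resume hG hD hI.wf hg hI.parked ht hu, hI.offPath, hI.detours⟩

theorem Invariant.reachable [Fintype V] (hG : G.IsTree) (hD : D = G.dist r g)
    (h : Reachable G r g f D ⊤ s) : Invariant G r g f D s := by
  induction h with
  | refl => exact invariant_init hG
  | tail _ hst ih => exact ih.step hG hD hst

end TreeX

/-! ### Counting -/

namespace TreeX

variable {V : Type*} {G : SimpleGraph V} {r g : V} {f : V → ℤ} {D : ℤ} {s s' : State V}

theorem sum_ncard_le_of_disjoint [Fintype V] {E : Set V} (A : V → Set V) (hA : ∀ a, A a ⊆ E)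
    (hd : ∀ a b u, u ∈ A a → u ∈ A b → a = b) : ∑ a, (A a).ncard ≤ E.ncard := by
  rw [← finsum_eq_sum_of_fintype, ← Set.ncard_iUnion_of_finite (fun i => Set.toFinite _)
      (fun a b hab => Set.disjoint_left.2 fun u ha hb => hab (hd a b u ha hb))]
  exact Set.ncard_le_ncard (Set.iUnion_subset hA) (Set.toFinite _)

theorem sum_ite_isChild_le [Fintype V] [DecidableRel G.Adj] {Δ : ℕ} (hΔ : ∀ v, G.degree v ≤ Δ)
    (h : V) [DecidablePred (IsChild G r h)] (n : ℕ) :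
    ∑ c, (if IsChild G r h c then n else 0) ≤ Δ * n := by
  rw [← Finset.sum_filter, Finset.sum_const, smul_eq_mul]
  gcongr
  refine (Finset.card_le_card ?_).trans ((G.card_neighborFinset_eq_degree h).le.trans (hΔ h))
  intro c hc
  rw [Finset.mem_filter] at hc
  exact (G.mem_neighborFinset h c).2 hc.2.1

/-- Every visited node off the path to the goal lies below a visited off-path child of a proper
ancestor of the goal. -/
theorem WellFormed.exists_branch (hG : G.IsTree) (hs : WellFormed G r g s) {u : V}
    (hu : u ∈ s.visited) (hug : ¬ IsAncestor G r u g) :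
    ∃ h c p, Branch G r g h c p ∧ c ∈ s.visited ∧ IsAncestor G r c u := by
  obtain ⟨h, hhu, hhg, hmax, -⟩ := exists_deepest_common_ancestor hG r u g
  obtain ⟨c, hc, hcu⟩ := hhu.exists_child hG (by rintro rfl; exact hug hhg)
  have hcs := hs.closed _ _ hu hcu
  have hcg : ¬ IsAncestor G r c g := fun hcg => hc.not_isAncestor (hmax c hcu hcg)
  have hne : h ≠ g := by
    rintro rfl
    have hcur := (hs.goal (hs.closed _ _ hcs hc.isAncestor)).1
    exact hs.fresh _ _ hs.mem_root c (hcur.symm ▸ hc) hcs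
  obtain ⟨p, hp, hpg⟩ := hhg.exists_child hG hne
  exact ⟨h, c, p, ⟨hc, hcg, hp, hpg⟩, hcs, hcu⟩

/-- The visited nodes off the path to the goal. -/
def visitedOffPath (G : SimpleGraph V) (r g : V) (S : Set V) : Set V :=
  {u | u ∈ S ∧ ¬ IsAncestor G r u g}

/-- A visited off-path child is the only one above a given node. -/
theorem Branch.unique (hG : G.IsTree) {h c p h' c' p' u : V} (hB : Branch G r g h c p)
    (hB' : Branch G r g h' c' p') (hu : IsAncestor G r c u) (hu' : IsAncestor G r c' u) :
    c = c' := by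
  by_contra hne
  rcases hu.total hG hu' with h₁ | h₁
  · exact hB.off ((h₁.of_child hG hB'.child hne).trans hG (hB'.anc hG))
  · exact hB'.off ((h₁.of_child hG hB.child (Ne.symm hne)).trans hG (hB.anc hG))

theorem Invariant.ncard_visitedOffPath_le [Fintype V] [DecidableRel G.Adj] (hG : G.IsTree)
    (hD : D = G.dist r g) {Δ : ℕ} (hΔ : ∀ v, G.degree v ≤ Δ) (hI : Invariant G r g f D s) :
    (visitedOffPath G r g s.visited).ncard ≤
      3 * (erroneous G g f).ncard + 4 * (Δ * (erroneous G g f).ncard) := by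
  classical
  set E := erroneous G g f with hE
  -- The visited nodes and the visited errors below the roots of the off-path subtrees.
  let N : V → Set V := fun c =>
    {u | (∃ h p, Branch G r g h c p) ∧ u ∈ visitedSubtree G r s.visited c}
  let X : V → Set V := fun c =>
    {u | (∃ h p, Branch G r g h c p) ∧ u ∈ visitedErrors G r g f s.visited c}
  -- The errors that witness a detour at `h`.
  let A : V → Set V := fun h => {u | u ∈ E ∧ IsAnchor G r f D u h}
  let B : V → Set V := fun h => {u | u ∈ E ∧ IsChild G r h u}
  have hX : ∑ c, (X c).ncard ≤ E.ncard := by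
    refine sum_ncard_le_of_disjoint X (fun c u hu => hu.2.2) ?_
    rintro c c' u ⟨⟨h, p, hB⟩, hu⟩ ⟨⟨h', p', hB'⟩, hu'⟩
    exact hB.unique hG hB' hu.1.2 hu'.1.2
  have hA : ∑ h, (A h).ncard ≤ E.ncard :=
    sum_ncard_le_of_disjoint A (fun _ _ hu => hu.1) fun _ _ _ ha hb => ha.2.unique hG hb.2
  have hB : ∑ h, (B h).ncard ≤ E.ncard :=
    sum_ncard_le_of_disjoint B (fun _ _ hu => hu.1) fun _ _ _ ha hb => ha.2.parent_unique hG hb.2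
  have hN : ∀ c, (N c).ncard ≤ 3 * (X c).ncard +
      ∑ h, if IsChild G r h c then 3 * (A h).ncard + (B h).ncard else 0 := by
    intro c
    by_cases hc : (∃ h p, Branch G r g h c p) ∧ c ∈ s.visited
    · obtain ⟨⟨h, p, hBr⟩, hcs⟩ := hc
      have hNc : N c = visitedSubtree G r s.visited c :=
        Set.ext fun u => and_iff_right ⟨h, p, hBr⟩
      have hXc : X c = visitedErrors G r g f s.visited c :=
        Set.ext fun u => and_iff_right ⟨h, p, hBr⟩
      obtain ⟨y, hy⟩ := hI.wf.mem_eq_some hcs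
      have h₁ := (hI.offPath h c p hBr y hy).1
      have h₂ : load G r f D s.visited h p ≤ (A h).ncard :=
        Set.ncard_le_ncard (fun u hu =>
          ⟨mem_erroneous_of_isAnchor hG hD hBr.childOn hBr.on hu.1.2 hu.2, hu.2⟩) (Set.toFinite _)
      have h₃ : 1 ≤ (A h).ncard + (B h).ncard := by
        rcases hI.detours h c p hBr hcs with ⟨e, he, heE⟩ | ⟨u, -, hpu, hu⟩
        · have : 0 < (B h).ncard := (Set.ncard_pos (Set.toFinite _)).2 ⟨e, heE, he⟩
          omega
        · have : 0 < (A h).ncard := (Set.ncard_pos (Set.toFinite _)).2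
            ⟨u, mem_erroneous_of_isAnchor hG hD hBr.childOn hBr.on hpu hu, hu⟩
          omega
      have h₄ := Finset.single_le_sum
        (f := fun h => if IsChild G r h c then 3 * (A h).ncard + (B h).ncard else 0)
        (fun _ _ => Nat.zero_le _) (Finset.mem_univ h)
      simp only [hBr.child, if_true] at h₄
      rw [hNc, hXc]
      omega
    · have : N c = ∅ := by
        ext u
        simp only [Set.mem_empty_iff_false, iff_false]
        exact fun hu => hc ⟨hu.1, hI.wf.closed _ _ hu.2.1 hu.2.2⟩
      rw [this]; simp
  have hsub : visitedOffPath G r g s.visited ⊆ ⋃ c, N c := by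
    rintro u ⟨hu, hug⟩
    obtain ⟨h, c, p, hBr, hcs, hcu⟩ := hI.wf.exists_branch hG hu hug
    exact Set.mem_iUnion.2 ⟨c, ⟨h, p, hBr⟩, hu, hcu⟩
  calc (visitedOffPath G r g s.visited).ncard ≤ (⋃ c, N c).ncard :=
        Set.ncard_le_ncard hsub (Set.toFinite _)
    _ ≤ ∑ c, (N c).ncard := Set.ncard_iUnion_le_of_fintype N
    _ ≤ ∑ c, (3 * (X c).ncard +
          ∑ h, if IsChild G r h c then 3 * (A h).ncard + (B h).ncard else 0) :=
        Finset.sum_le_sum fun c _ => hN c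
    _ = 3 * ∑ c, (X c).ncard +
          ∑ h, ∑ c, if IsChild G r h c then 3 * (A h).ncard + (B h).ncard else 0 := by
        rw [Finset.sum_add_distrib, ← Finset.mul_sum, Finset.sum_comm]
    _ ≤ 3 * ∑ c, (X c).ncard + ∑ h, Δ * (3 * (A h).ncard + (B h).ncard) := by
        gcongr with h
        exact sum_ite_isChild_le hΔ h _
    _ = 3 * ∑ c, (X c).ncard + Δ * (3 * ∑ h, (A h).ncard + ∑ h, (B h).ncard) := by
        rw [← Finset.mul_sum, Finset.sum_add_distrib, ← Finset.mul_sum]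
    _ ≤ 3 * E.ncard + Δ * (3 * E.ncard + E.ncard) := by gcongr
    _ = 3 * E.ncard + 4 * (Δ * E.ncard) := by ring

/-- Nodes that contribute to a load are off the path to the goal or erroneous. -/
theorem IsLedger.sum_le [Fintype V] (hG : G.IsTree) (hD : D = G.dist r g) {L : V → ℕ}
    (hL : IsLedger G r f D s L) :
    ∑ k, L k ≤ 8 * ((visitedOffPath G r g s.visited).ncard + (erroneous G g f).ncard) := by
  let A : V → Set V := fun k =>
    {u | u ∈ s.visited ∧ IsAncestor G r k u ∧ ∃ a, IsChild G r a k ∧ IsAnchor G r f D u a}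
  have hA : ∑ k, (A k).ncard ≤ (visitedOffPath G r g s.visited ∪ erroneous G g f).ncard := by
    refine sum_ncard_le_of_disjoint A ?_ ?_
    · rintro k u ⟨hu, hku, a, hak, ha⟩
      by_contra hcon
      obtain ⟨h₁, h₂⟩ := not_or.1 hcon
      have hug : IsAncestor G r u g := by
        by_contra h
        exact h₁ ⟨hu, h⟩
      obtain rfl := ha.unique hG (hug.isAnchor_self hG hD (not_not.1 h₂))
      exact hak.not_isAncestor hku
    · rintro k k' u ⟨-, hku, a, hak, ha⟩ ⟨-, hku', a', hak', ha'⟩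
      obtain rfl := ha.unique hG ha'
      exact hak.eq_of_isAncestor hG hak' hku hku'
  have hLA : ∀ k, L k ≤ 8 * (A k).ncard := by
    intro k
    by_cases hk : k = r
    · rw [hk, hL.root]; exact Nat.zero_le _
    · obtain ⟨a, ha⟩ := exists_parent hG hk
      refine (hL.le_load a k ha).trans ?_
      gcongr
      exact Set.ncard_le_ncard (fun u hu => ⟨hu.1.1, hu.1.2, a, ha, hu.2⟩) (Set.toFinite _)
  calc ∑ k, L k ≤ ∑ k, 8 * (A k).ncard := Finset.sum_le_sum fun k _ => hLA k
    _ = 8 * ∑ k, (A k).ncard := by rw [Finset.mul_sum]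
    _ ≤ _ := by gcongr; exact hA.trans (Set.ncard_union_le _ _)

theorem Invariant.cost_le [Fintype V] [DecidableRel G.Adj] (hG : G.IsTree)
    (hD : D = G.dist r g) {Δ : ℕ} (hΔ : ∀ v, G.degree v ≤ Δ) (hΔ₁ : 1 ≤ Δ)
    (hI : Invariant G r g f D s) :
    s.cost ≤ G.dist r g + 78 * (Δ * (erroneous G g f).ncard) := by
  obtain ⟨L, hL, hle⟩ := hI.cost
  have h₁ := hL.sum_le hG hD
  have h₂ := hI.ncard_visitedOffPath_le hG hD hΔ
  have h₃ : (deadSet G r g s).ncard ≤ (visitedOffPath G r g s.visited).ncard := by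
    refine Set.ncard_le_ncard (fun x hx => ⟨?_, hx.1⟩) (Set.toFinite _)
    by_contra h
    exact hx.2.1 (.of_notMem h)
  have h₄ : s.visited.ncard ≤ (visitedOffPath G r g s.visited).ncard + (G.dist r g + 1) := by
    rw [← (isAncestor_root G r g).ncard_between hG]
    refine le_trans (Set.ncard_le_ncard (fun x hx => ?_) (Set.toFinite _)) (Set.ncard_union_le _ _)
    by_cases hxg : IsAncestor G r x g
    · exact Or.inr ⟨isAncestor_root .., hxg⟩
    · exact Or.inl ⟨hx, hxg⟩
  have h₅ : (erroneous G g f).ncard ≤ Δ * (erroneous G g f).ncard := Nat.le_mul_of_pos_left _ hΔ₁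
  omega

/-! ### Progress and termination -/

theorem exists_step [Finite V] (hG : G.IsTree) (hs : WellFormed G r g s) (hg : g ∉ s.visited) :
    ∃ s', Step G r g f D ⊤ s s' := by
  rcases hp : s.pending with _ | u
  · have hE : EntersLoop g ⊤ s := by
      refine ⟨hp, ?_, ?_⟩
      · rintro rfl; exact hg hs.cur_mem
      · exact (Set.toFinite _).encard_lt_top
    by_cases hc : ∃ a q, CallsBack G r f D s a q
    · obtain ⟨a, q, h⟩ := hc
      rcases hm : s.mem q with _ | u
      · exact ⟨_, .callbackNew a q hE h hm⟩
      · exact ⟨_, .callbackResume a q u hE h hm⟩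
    · exact ⟨_, .proceed hE hc⟩
  · by_cases hu : ∃ c, IsChild G r u c
    · obtain ⟨x, hx, hmin⟩ := Set.exists_min_image {c | IsChild G r u c} f (Set.toFinite _) hu
      exact ⟨_, .descend u x hp hx hmin⟩
    · have huV : u ∈ s.visited := by
        have := hs.focus_mem
        rwa [State.focus, hp] at this
      have hr : IsActive G r s.visited r :=
        (isActive_iff_of_mem hG hs.root_mem).2 ⟨g, isAncestor_root .., hg⟩
      obtain ⟨w, ⟨hwu, hwa⟩, hmax⟩ := Set.exists_max_image
        {w | IsAncestor G r w u ∧ IsActive G r s.visited w} (level G r) (Set.toFinite _)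
        ⟨r, isAncestor_root .., hr⟩
      have hwV := hs.closed _ _ huV hwu
      obtain ⟨d, hwd, hd⟩ := (isActive_iff_of_mem hG hwV).1 hwa
      obtain ⟨i, hi, hid⟩ := hwd.exists_child hG (by rintro rfl; exact hd hwV)
      obtain ⟨q, ⟨hq, hqa⟩, hmin⟩ := Set.exists_min_image
        {i | IsChild G r w i ∧ IsActive G r s.visited i} (load G r f D s.visited w) (Set.toFinite _)
        ⟨i, hi, (isActive_iff_of_isChild hG hwV hi).2 ⟨d, hid, hd⟩⟩
      have hw : IsClosestActiveAncestor G r s.visited u w :=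
        ⟨hwu, hwa, fun w' h₁ h₂ => hmax w' ⟨h₁, h₂⟩⟩
      have hql : IsLeastLoaded G r f D s.visited w q :=
        ⟨hq, hqa, fun i h₁ h₂ => hmin i ⟨h₁, h₂⟩⟩
      rcases hm : s.mem q with _ | u'
      · exact ⟨_, .backtrackNew u w q hp hu hw hql hm⟩
      · exact ⟨_, .backtrackResume u w q u' hp hu hw hql hm⟩

/-- The ancestors of the focus whose subtree has unvisited nodes. -/
def openAncestors (G : SimpleGraph V) (r : V) (s : State V) : Set V :=
  {x | HasUnvisited G r s.visited x ∧ IsAncestor G r x s.focus}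

open Classical in
/-- A measure that decreases with every step: a visit decreases the number of unvisited nodes, and
resuming the search while backtracking increases the number of open ancestors of the focus. -/
noncomputable def stepMeasure [Fintype V] (G : SimpleGraph V) (r : V) (s : State V) : ℕ :=
  (Fintype.card V - s.visited.ncard) * (Fintype.card V + 2) +
    if s.pending = none then Fintype.card V + 1
    else Fintype.card V - (openAncestors G r s).ncard

theorem stepMeasure_visit_lt [Fintype V] {z : V} (hz : z ∉ s.visited) :
    stepMeasure G r (s.visit G r z) < stepMeasure G r s := by
  have h₁ : (s.visit G r z).visited.ncard = s.visited.ncard + 1 :=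
    Set.ncard_insert_of_notMem hz (Set.toFinite _)
  have h₂ : (s.visit G r z).visited.ncard ≤ Fintype.card V := by
    rw [← Nat.card_eq_fintype_card]; exact Set.ncard_le_card _
  have h₃ : (s.visit G r z).pending = none := rfl
  obtain ⟨n, hn⟩ : ∃ n, Fintype.card V - s.visited.ncard = n + 1 :=
    ⟨Fintype.card V - s.visited.ncard - 1, by omega⟩
  have h₄ : Fintype.card V - (s.visit G r z).visited.ncard = n := by omega
  unfold stepMeasure
  rw [h₃, if_pos rfl, h₄, hn, add_mul]
  omega

theorem Step.stepMeasure_lt [Fintype V] (hG : G.IsTree) (hs : WellFormed G r g s)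
    (h : Step G r g f D ⊤ s s') : stepMeasure G r s' < stepMeasure G r s := by
  have hpos : ∀ t : State V, t.visited = s.visited → s.pending = none → t.pending ≠ none →
      stepMeasure G r t < stepMeasure G r s := by
    intro t h₁ h₂ h₃
    unfold stepMeasure
    rw [h₁, if_pos h₂, if_neg h₃]
    omega
  cases h.move hG hs with
  | proceed hp _ => exact hpos _ rfl hp (by simp)
  | descend u x hp hx _ =>
    exact stepMeasure_visit_lt (hs.visits_of_descend (f := f) (D := D) hp hx).new
  | turn w q _ hq => exact stepMeasure_visit_lt hq
  | resume w q u ht hu =>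
    rcases ht.leaves with ⟨j, hj⟩ | ⟨hp, hl⟩
    · exact hpos _ rfl hj.pending (by simp)
    · have hss : openAncestors G r s ⊂ openAncestors G r { s with pending := some u } := by
        have hqu := hs.mem_anc _ _ hu
        refine (Set.ssubset_iff_of_subset ?_).2 ⟨q, ⟨ht.unvisited, hqu⟩, fun h => ht.off h.2⟩
        exact fun x hx => ⟨hx.1, ((hl x hx.1 hx.2).trans hG ht.child.isAncestor).trans hG hqu⟩
      have h₁ := Set.ncard_lt_ncard hss (Set.toFinite _)
      have h₂ : (openAncestors G r { s with pending := some u }).ncard ≤ Fintype.card V := by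
        rw [← Nat.card_eq_fintype_card]; exact Set.ncard_le_card _
      unfold stepMeasure
      rw [if_neg hp, if_neg (by simp)]
      dsimp only
      omega

theorem Step.moves_to_frontier (hG : G.IsTree) (hs : WellFormed G r g s)
    (h : Step G r g f D ⊤ s s') :
    (s'.cur = s.cur ∧ s'.visited = s.visited ∧ s'.cost = s.cost) ∨
      (s'.cur ∈ frontier G s.visited ∧ s'.visited = insert s'.cur s.visited ∧
        s'.cost = s.cost + G.dist s.cur s'.cur) := by
  have hvis : ∀ w z, Visits G r f D s w z → z ∈ frontier G s.visited := fun w z hz =>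
    ⟨hz.new, w, hs.closed _ _ hs.focus_mem hz.anc, hz.child.1⟩
  cases h.move hG hs with
  | proceed => exact Or.inl ⟨rfl, rfl, rfl⟩
  | descend u x hp hx _ => exact Or.inr ⟨hvis _ _ (hs.visits_of_descend hp hx), rfl, rfl⟩
  | turn w q ht hq => exact Or.inr ⟨hvis _ _ (ht.visits hq), rfl, rfl⟩
  | resume => exact Or.inl ⟨rfl, rfl, rfl⟩

theorem not_exists_infinite_run [Fintype V] (hG : G.IsTree) (hD : D = G.dist r g) :
    ¬ ∃ s : ℕ → State V, s 0 = init r ∧ ∀ n, Step G r g f D ⊤ (s n) (s (n + 1)) := by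
  rintro ⟨s, h0, hstep⟩
  have hreach : ∀ n, Reachable G r g f D ⊤ (s n) := by
    intro n
    induction n with
    | zero => rw [h0]; exact .refl
    | succ n ih => exact ih.tail (hstep n)
  have hlt : ∀ n, stepMeasure G r (s (n + 1)) < stepMeasure G r (s n) := fun n =>
    (hstep n).stepMeasure_lt hG (Invariant.reachable hG hD (hreach n)).wf
  have hle : ∀ n, stepMeasure G r (s n) + n ≤ stepMeasure G r (s 0) := by
    intro n
    induction n with
    | zero => rfl
    | succ n ih => have := hlt n; omega
  have := hle (stepMeasure G r (s 0) + 1)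
  omega

theorem eq_init_of_reachable_of_root_eq_goal (hG : G.IsTree)
    (h : Reachable G r r f D ⊤ s) : s = init r := by
  rcases h.cases_head with h | ⟨t, ht, -⟩
  · exact h.symm
  · exact absurd (Set.mem_singleton r) (ht.goal_notMem (wellFormed_init hG r r))

end TreeX

theorem theorem3 :
    ∃ K : ℕ, ∀ (V : Type*) [Fintype V] (G : SimpleGraph V) [DecidableRel G.Adj] (r g : V)
      (f : V → ℤ) (D : ℤ) (Δ : ℕ),
      G.IsTree → (∀ v, G.degree v ≤ Δ) → D = (G.dist r g : ℤ) →
      -- every run of the program terminates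
      (¬ ∃ s : ℕ → TreeX.State V, s 0 = TreeX.init r ∧
        ∀ n, TreeX.Step G r g f D ⊤ (s n) (s (n + 1))) ∧
      ∀ s : TreeX.State V, TreeX.Reachable G r g f D ⊤ s →
        -- the agent only ever moves to unvisited neighbours of the visited nodes
        (∀ s', TreeX.Step G r g f D ⊤ s s' →
          (s'.cur = s.cur ∧ s'.visited = s.visited ∧ s'.cost = s.cost) ∨
          (s'.cur ∈ TreeX.frontier G s.visited ∧ s'.visited = insert s'.cur s.visited ∧
            s'.cost = s.cost + G.dist s.cur s'.cur)) ∧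
        -- where a run ends, the agent is at the goal, and the cost is bounded
        ((∀ s', ¬ TreeX.Step G r g f D ⊤ s s') →
          s.cur = g ∧ s.cost ≤ G.dist r g + K * (Δ * (TreeX.erroneous G g f).ncard)) := by
  refine ⟨78, fun V _ G _ r g f D Δ hG hΔ hD => ⟨TreeX.not_exists_infinite_run hG hD,
    fun s hs => ?_⟩⟩
  have hI := TreeX.Invariant.reachable hG hD hs
  refine ⟨fun s' h => h.moves_to_frontier hG hI.wf, fun hend => ⟨?_, ?_⟩⟩
  · by_contra hne
    obtain ⟨s', h⟩ := TreeX.exists_step (f := f) (D := D) hG hI.wf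
      (fun hg => hne (hI.wf.goal hg).1)
    exact hend s' h
  · by_cases hrg : r = g
    · subst hrg
      rw [TreeX.eq_init_of_reachable_of_root_eq_goal hG hs]
      exact Nat.zero_le _
    · have hΔ₁ : 1 ≤ Δ := by
        obtain ⟨c, hc, -⟩ := TreeX.exists_adj_dist_add_one hG hrg
        exact ((G.degree_pos_iff_exists_adj r).2 ⟨c, hc⟩).trans_le (hΔ r)
      exact hI.cost_le hG hD hΔ hΔ₁
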